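/- **Setting.** Let $K$ be a field complete for a discrete valuation $\mathrm{val}\colon K\to\mathbb R\sqcup\{\infty\}$ (so $\mathrm{val}(K^\times)=e\mathbb Z$ for some real $e>0$). Write $T=\{\mathbf X^\alpha:\alpha\in\mathbb Z^n\}$, the group of Laurent monomials. Let $\mathcal P\subset\mathbb R^n$ be a nonempty polytope with vertices $r_1,\dots,r_t\in\mathbb Q^n$ (indexed without repetition), $P=\mathcal P\cap\mathbb Q^n$, $I_P=\{1,\dots,t\}$, and $$K\{\mathbf X;P\}=\Big\{\sum_{u\in\mathbb Z^n}a_u\mathbf X^u:\ a_u\in K,\ \mathrm{val}(a_u)-r\cdot u\to+\infty \text{ as } |u|\to\infty \text{ for all } r\in P\Big\}.$$ For $f=\sum a_u\mathbf X^u$ in it put $\mathrm{val}_r(f)=\min_u(\mathrm{val}(a_u)-r\cdot u)$ for $r\in P$, $\mathrm{val}_P(f)=\inf_{r\in P}\mathrm{val}_r(f)$ and $I_P(f)=\{i\in I_P:\mathrm{val}_P(f)=\mathrm{val}_{r_i}(f)\}$; let $\mathrm{in}_{r}(f)$ be the sum of the terms of $f$ whose $\mathrm{val}_r$ equals $\mathrm{val}_r(f)$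 (a Laurent polynomial for $r\in P$). Put $V_i=\{m\in T: i\in I_P(m)\}$ and $V_{i,<}=\{m\in T:\min I_P(m)=i\}$. A *conic decomposition* of $S\subseteq T$ is a finite family of finitely generated submonoids of $T$ with union $S$, each having $1$ as its only invertible element and generating the group $T$. Fix for every $i\in I_P$ a conic decomposition $(T_{i,j})_{j\in D_i}$ of $V_i$, and put $L=\{(i,j):i\in I_P,\ j\in D_i\}$. Let $\le_\omega$ be a *generalized monomial order* for the $T_{i,j}$: a total order on $T$ with $1\le_\omega m$ for all $m\in T$, such that $m<_\omega s$ implies $mt<_\omega st$ whenever $m\in T$, $(i,j)\in L$ and $s,t\in T_{i,j}$. The preorder $\le_P$ on terms $a\mathbf X^u$ ($a\ne0$) is: $a\mathbf X^u\le_P b\mathbf X^v$ iff $\mathrm{val}_P(b\mathbf X^v)<\mathrm{val}_P(a\mathbf X^u)$; or these are equal and $\min I_P(b\mathbf X^v)<\min I_P(a\mathbf X^u)$; or both are equal and $\mathbf X^u\le_\omega\mathbf X^v$. For $f\neq0$ let $\mathrm{lm}(f),\mathrm{lc}(f),\mathrm{lt}(f)$ be the leading monomial, coefficient and term for $\le_P$.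 Let $\mathrm{lm}_{i,j}(f)$ be the monomial $\mathrm{lm}_\omega(t\,\mathrm{in}_{r_i}(f))\,t^{-1}$, where $\mathrm{lm}_\omega$ is the $\le_\omega$-greatest monomial of a Laurent polynomial and $t\in T$ is any monomial with $\mathrm{lm}_\omega(t\,\mathrm{in}_{r_i}(f))\in T_{i,j}$ (it does not depend on $t$); let $\mathrm{lc}_{i,j}(f)$ be its coefficient in $\mathrm{in}_{r_i}(f)$, $\mathrm{lt}_{i,j}(f)=\mathrm{lc}_{i,j}(f)\,\mathrm{lm}_{i,j}(f)$, and $T_{i,j}(f)=\{t\in T:\mathrm{lm}(tf)\in T_{i,j}\cap V_{i,<}\}$. A *Gröbner basis* of an ideal $J$ is a finite $G\subset J\setminus\{0\}$ with $\{\mathrm{lm}(f):f\in J\setminus\{0\}\}=\bigcup_{g\in G,\,(i,j)\in L}T_{i,j}(g)\,\mathrm{lm}_{i,j}(g)$. For $v\in \mathrm{lm}_{i,j}(f)T_{i,j}(f)\cap\mathrm{lm}_{i,j}(g)T_{i,j}(g)$ the *S-pair* is $$S((i,j),f,g,v)=\mathrm{lc}_{i,j}(g)\tfrac{v}{\mathrm{lm}_{i,j}(f)}f-\mathrm{lc}_{i,j}(f)\tfrac{v}{\mathrm{lm}_{i,j}(g)}g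 .$$ *Division* of $f$ by a family $H=(h_1,\dots,h_m)$ of nonzero elements is the following (possibly infinite) procedure, starting with $q_1=\dots=q_m=s=0$. While $f\ne0$: if $\mathrm{lm}\big(\frac{\mathrm{lm}(f)}{\mathrm{lm}_{i,j}(h_k)}h_k\big)=\mathrm{lm}(f)$ for some $(i,j)\in L$ and $k$, choose such $(i,j)$ and $k$, put $t=\mathrm{lt}(f)/\mathrm{lt}_{i,j}(h_k)$, replace $f$ by $f-th_k$ and $q_k$ by $q_k+t$; otherwise replace $s$ by $s+\mathrm{lt}(f)$ and $f$ by $f-\mathrm{lt}(f)$. The remainder is the limit of the successive values of $s$ for $\mathrm{val}_P$. **Proposition (Buchberger criterion).** Let $H=(h_1,\dots,h_m)$ be a family of nonzero elements of $K\{\mathbf X;P\}$ and $J$ the ideal generated by $H$. For each $(i,j)\in L$ and each $h_s\neq h_k$ in $H$ let $U((i,j),h_s,h_k)$ be a finite system of generators of the $T_{i,j}$-module $\mathrm{lm}_{i,j}(h_s)T_{i,j}(h_s)\cap\mathrm{lm}_{i,j}(h_k)T_{i,j}(h_k)$. The following are equivalent: 1. $H$ is a Gröbner basis of $J$; 2.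 for all $(i,j)\in L$, $h_s\ne h_k$ and $v\in U((i,j),h_s,h_k)$, the division of $S((i,j),h_s,h_k,v)$ by $H$ has remainder $0$, whatever choices are made in it; 3. for all $(i,j)\in L$, $h_s\ne h_k$ and $v\in U((i,j),h_s,h_k)$, the division of $S((i,j),h_s,h_k,v)$ by $H$ has remainder $0$ for some choices. -/

import Mathlib

open Filter Topology

namespace Polytopal

/-! ### Complete discretely valued fields

The valued field is a complete ultrametric normed field `K`, with valuation `val x = -log ‖x‖`;
every valuation `K → ℝ ∪ {∞}` is of this form, for the norm `exp (-val x)`. -/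

/-- The valuation `val : K → ℝ ∪ {∞}` of an ultrametric normed field. -/
noncomputable def val {K : Type*} [NormedField K] (x : K) : EReal :=
  open Classical in if x = 0 then ⊤ else ((-Real.log ‖x‖ : ℝ) : EReal)

/-- The valuation is discrete: there is a uniformizer `π`, and the value group is generated by
the value of `π`. -/
def IsDiscretelyValued (K : Type*) [NormedField K] : Prop :=
  ∃ π : K, 0 < ‖π‖ ∧ ‖π‖ < 1 ∧ ∀ x : K, x ≠ 0 → ∃ m : ℤ, ‖x‖ = ‖π‖ ^ m

/-! ### Polytopes with rational vertices -/

/-- The group `T` of Laurent monomials `X^u`, written additively through exponents `u ∈ ℤⁿ`. -/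
abbrev Mon (n : ℕ) : Type := Fin n → ℤ

/-- The point of `ℝⁿ` with the given rational coordinates. -/
def toReal {n : ℕ} (r : Fin n → ℚ) : Fin n → ℝ := fun k => (r k : ℝ)

/-- A nonempty polytope in `ℝⁿ` with rational vertices, together with an indexing
`r_1, …, r_t` of its vertices: the polytope is the convex hull of the `r_i`, and the `r_i` are
exactly its extreme points, without repetition. -/
structure RatPolytope (n : ℕ) where
  numVert : ℕ
  numVert_pos : 0 < numVert
  vert : Fin numVert → Fin n → ℚ
  vert_injective : Function.Injective vert
  extremePoints_eq : Set.extremePoints ℝ (convexHull ℝ (Set.range fun i => toReal (vert i))) =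
    Set.range fun i => toReal (vert i)

/-- The polytope itself, as a subset of `ℝⁿ`. -/
def RatPolytope.carrier {n : ℕ} (P : RatPolytope n) : Set (Fin n → ℝ) :=
  convexHull ℝ (Set.range fun i => toReal (P.vert i))

/-- The set `P` of rational points of the polytope. -/
def RatPolytope.points {n : ℕ} (P : RatPolytope n) : Set (Fin n → ℚ) :=
  {r | toReal r ∈ P.carrier}

theorem RatPolytope.vert_mem {n : ℕ} (P : RatPolytope n) (i : Fin P.numVert) :
    P.vert i ∈ P.points :=
  subset_convexHull ℝ _ ⟨i, rfl⟩

/-- The scalar product `r · u`. -/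
def dot {n : ℕ} (r : Fin n → ℚ) (u : Mon n) : ℝ := ∑ k, (r k : ℝ) * (u k : ℝ)

theorem dot_add {n : ℕ} (r : Fin n → ℚ) (u v : Mon n) : dot r (u + v) = dot r u + dot r v := by
  simp [dot, mul_add, Finset.sum_add_distrib]

/-! ### The polytopal affinoid algebra -/

/-- The convergence condition `val (a_u) - r · u → ∞` as `|u| → ∞`. -/
def ConvergesAt {K : Type*} [NormedField K] {n : ℕ} (r : Fin n → ℚ) (a : Mon n → K) : Prop :=
  Tendsto (fun u => val (a u) - (dot r u : EReal)) cofinite (𝓝 ⊤)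

/-- The polytopal affinoid algebra `K{X;P}`: the Laurent series `∑ a_u X^u` over `ℤⁿ` with
`val (a_u) - r · u → ∞` for all rational points `r` of the polytope. -/
@[ext]
structure PolytopalAlgebra (K : Type*) [NormedField K] {n : ℕ} (P : RatPolytope n) where
  coeff : Mon n → K
  converges : ∀ r ∈ P.points, ConvergesAt r coeff

theorem lt_val_sub_iff {K : Type*} [NormedField K] (a : K) (c x : ℝ) :
    (x : EReal) < val a - (c : EReal) ↔ ‖a‖ * Real.exp c < Real.exp (-x) := by
  unfold val
  split_ifs with h
  · simp [h, Real.exp_pos]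
  · have h0 : 0 < ‖a‖ := norm_pos_iff.mpr h
    rw [← EReal.coe_sub, EReal.coe_lt_coe_iff]
    conv_rhs => rw [← Real.exp_log h0, ← Real.exp_add, Real.exp_lt_exp]
    constructor <;> intro h <;> linarith

theorem convergesAt_iff {K : Type*} [NormedField K] {n : ℕ} (r : Fin n → ℚ) (a : Mon n → K) :
    ConvergesAt r a ↔ Tendsto (fun u => ‖a u‖ * Real.exp (dot r u)) cofinite (𝓝 0) := by
  unfold ConvergesAt
  rw [EReal.tendsto_nhds_top_iff_real]
  simp only [lt_val_sub_iff]
  rw [Metric.tendsto_nhds]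
  have key : ∀ u, dist (‖a u‖ * Real.exp (dot r u)) 0 = ‖a u‖ * Real.exp (dot r u) := fun u => by
    rw [Real.dist_eq, sub_zero, abs_of_nonneg (by positivity)]
  simp only [key]
  constructor
  · intro h ε hε
    simpa [Real.exp_log hε] using h (-Real.log ε)
  · intro h x
    exact h _ (Real.exp_pos _)

section Ring

variable {K : Type*} [NormedField K] {n : ℕ}

theorem ConvergesAt.of_finite {r : Fin n → ℚ} {a : Mon n → K} (h : {u | a u ≠ 0}.Finite) :
    ConvergesAt r a := by
  rw [convergesAt_iff]
  refine tendsto_const_nhds.congr' ?_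
  have : ∀ᶠ u in cofinite, a u = 0 := by simpa [eventually_cofinite] using h
  filter_upwards [this] with u hu
  simp [hu]

theorem ConvergesAt.add {r : Fin n → ℚ} {a b : Mon n → K} (ha : ConvergesAt r a)
    (hb : ConvergesAt r b) : ConvergesAt r (fun u => a u + b u) := by
  rw [convergesAt_iff] at *
  refine squeeze_zero (fun u => by positivity) (fun u => ?_) (by simpa using ha.add hb)
  rw [← add_mul]
  exact mul_le_mul_of_nonneg_right (norm_add_le _ _) (Real.exp_pos _).le

theorem ConvergesAt.neg {r : Fin n → ℚ} {a : Mon n → K} (ha : ConvergesAt r a) :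
    ConvergesAt r (fun u => -a u) := by
  rw [convergesAt_iff] at *
  simpa using ha

/-- The coefficients of the product of two Laurent series. -/
noncomputable def conv (a b : Mon n → K) : Mon n → K := fun u => ∑' w, a w * b (u - w)

theorem conv_comm (a b : Mon n → K) : conv a b = conv b a := by
  funext u
  unfold conv
  rw [← (Equiv.subLeft u).tsum_eq]
  simp [mul_comm]

variable [IsUltrametricDist K]

theorem ConvergesAt.conv {r : Fin n → ℚ} {a b : Mon n → K} (ha : ConvergesAt r a)
    (hb : ConvergesAt r b) : ConvergesAt r (conv a b) := by
  rw [convergesAt_iff] at *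
  have h := tendsto_mul_cofinite_nhds_zero ha hb
  rw [Metric.tendsto_nhds] at h ⊢
  intro ε hε
  have h2 := h (ε / 2) (by positivity)
  rw [eventually_cofinite] at h2 ⊢
  refine (h2.image fun p => p.1 + p.2).subset ?_
  intro u hu
  by_contra hcon
  apply hu
  have hb : ∀ w, ‖a w * b (u - w)‖ ≤ ε / 2 * Real.exp (-dot r u) := by
    intro w
    have : ¬ ¬ dist (‖a w‖ * Real.exp (dot r w) * (‖b (u - w)‖ * Real.exp (dot r (u - w)))) 0
        < ε / 2 := fun hw => hcon ⟨(w, u - w), hw, by simp⟩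
    rw [not_not, Real.dist_eq, sub_zero, abs_of_nonneg (by positivity)] at this
    have e : dot r u = dot r w + dot r (u - w) := by rw [← dot_add]; simp
    rw [norm_mul, Real.exp_neg, ← div_eq_mul_inv, le_div_iff₀ (Real.exp_pos _), e, Real.exp_add]
    nlinarith
  have hn : ‖Polytopal.conv a b u‖ ≤ ε / 2 * Real.exp (-dot r u) :=
    IsUltrametricDist.norm_tsum_le_of_forall_le_of_nonneg (by positivity) hb
  rw [Real.dist_eq, sub_zero, abs_of_nonneg (by positivity)]
  have := mul_le_mul_of_nonneg_right hn (Real.exp_pos (dot r u)).le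
  rw [mul_assoc, ← Real.exp_add] at this
  simp only [neg_add_cancel, Real.exp_zero, mul_one] at this
  linarith

variable [CompleteSpace K]

theorem summable_triple {r : Fin n → ℚ} {a b c : Mon n → K} (ha : ConvergesAt r a)
    (hb : ConvergesAt r b) (hc : ConvergesAt r c) (u : Mon n) :
    Summable fun p : Mon n × Mon n => a p.1 * b p.2 * c (u - p.1 - p.2) := by
  apply NonarchimedeanAddGroup.summable_of_tendsto_cofinite_zero
  rw [convergesAt_iff] at *
  have h := tendsto_mul_cofinite_nhds_zero ha hb
  obtain ⟨C, hC⟩ := hc.bddAbove_range_of_cofinite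
  have hC' : ∀ w, ‖c w‖ * Real.exp (dot r w) ≤ C := fun w => hC ⟨w, rfl⟩
  have h' := h.mul_const (C * Real.exp (-dot r u))
  rw [zero_mul] at h'
  rw [tendsto_zero_iff_norm_tendsto_zero]
  refine squeeze_zero (fun _ => norm_nonneg _) (fun p => ?_) h'
  have e : dot r u = dot r p.1 + dot r p.2 + dot r (u - p.1 - p.2) := by
    rw [← dot_add, ← dot_add]; congr 1; abel
  have h1 := hC' (u - p.1 - p.2)
  have : ‖c (u - p.1 - p.2)‖ ≤ C * Real.exp (-dot r (u - p.1 - p.2)) := by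
    rw [Real.exp_neg, ← div_eq_mul_inv, le_div_iff₀ (Real.exp_pos _)]; exact h1
  rw [norm_mul, norm_mul]
  calc ‖a p.1‖ * ‖b p.2‖ * ‖c (u - p.1 - p.2)‖
      ≤ ‖a p.1‖ * ‖b p.2‖ * (C * Real.exp (-dot r (u - p.1 - p.2))) := by gcongr
    _ = _ := by
        have e2 : -dot r (u - p.1 - p.2) = dot r p.1 + dot r p.2 + -dot r u := by linarith
        rw [e2, Real.exp_add, Real.exp_add]; ring

theorem summable_conv {r : Fin n → ℚ} {a b : Mon n → K} (ha : ConvergesAt r a)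
    (hb : ConvergesAt r b) (u : Mon n) : Summable fun w => a w * b (u - w) := by
  classical
  have hd : ConvergesAt r (fun w : Mon n => if w = 0 then (1 : K) else 0) :=
    .of_finite ((Set.finite_singleton 0).subset fun w hw => by
      by_contra h; exact hw (if_neg h))
  have := (summable_triple hd ha hb u).prod_factor 0
  simpa using this

theorem conv_assoc {r : Fin n → ℚ} {a b c : Mon n → K} (ha : ConvergesAt r a)
    (hb : ConvergesAt r b) (hc : ConvergesAt r c) :
    conv (conv a b) c = conv a (conv b c) := by
  funext u
  have hs := summable_triple ha hb hc u
  have h2 : conv a (conv b c) u = ∑' p : Mon n × Mon n, a p.1 * b p.2 * c (u - p.1 - p.2) := by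
    rw [hs.tsum_prod]
    simp only [conv, ← tsum_mul_left, mul_assoc]
  rw [h2]
  let e : Mon n × Mon n ≃ Mon n × Mon n :=
    { toFun := fun p => (p.2, p.1 - p.2)
      invFun := fun p => (p.1 + p.2, p.1)
      left_inv := fun p => by ext <;> simp
      right_inv := fun p => by ext <;> simp }
  have hs' : Summable fun p : Mon n × Mon n =>
      a (e p).1 * b (e p).2 * c (u - (e p).1 - (e p).2) := (e.summable_iff).mpr hs
  rw [← e.tsum_eq, hs'.tsum_prod]
  simp only [conv, ← tsum_mul_right]
  refine tsum_congr fun w => tsum_congr fun z => ?_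
  simp [e]

end Ring

namespace PolytopalAlgebra

variable {K : Type*} [NormedField K] {n : ℕ} {P : RatPolytope n}

theorem conv_at_vertex (f : PolytopalAlgebra K P) :
    ConvergesAt (P.vert ⟨0, P.numVert_pos⟩) f.coeff :=
  f.converges _ (P.vert_mem _)

/-- The term `a X^u`. -/
def term (a : K) (u : Mon n) : PolytopalAlgebra K P where
  coeff := fun w => if w = u then a else 0
  converges _ _ := .of_finite ((Set.finite_singleton u).subset fun w hw => by
    by_contra h; exact hw (if_neg h))

/-- The monomial `X^u`. -/
abbrev mono (u : Mon n) : PolytopalAlgebra K P := term 1 u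

/-- The valuation `val_r (f) = min_u (val (a_u) - r · u)`. -/
noncomputable def valr (r : Fin n → ℚ) (f : PolytopalAlgebra K P) : EReal :=
  ⨅ u, (val (f.coeff u) - (dot r u : EReal))

/-- `val_P (f) = inf_{r ∈ P} val_r (f)`. -/
noncomputable def valP (f : PolytopalAlgebra K P) : EReal :=
  ⨅ r ∈ P.points, valr r f

/-- The set `I_P(f)` of the indices `i` such that `val_P (f)` is attained at the vertex `r_i`. -/
noncomputable def IP (f : PolytopalAlgebra K P) : Finset (Fin P.numVert) :=
  open Classical in Finset.univ.filter fun i => valP f = valr (P.vert i) f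

theorem finite_initial (i : Fin P.numVert) (f : PolytopalAlgebra K P) :
    {u | f.coeff u ≠ 0 ∧
      val (f.coeff u) - (dot (P.vert i) u : EReal) = valr (P.vert i) f}.Finite := by
  by_cases h : ∃ u₀, f.coeff u₀ ≠ 0 ∧
      val (f.coeff u₀) - (dot (P.vert i) u₀ : EReal) = valr (P.vert i) f
  · obtain ⟨u₀, h0, h1⟩ := h
    have hf := EReal.tendsto_nhds_top_iff_real.mp (f.converges _ (P.vert_mem i))
      (-Real.log ‖f.coeff u₀‖ - dot (P.vert i) u₀)
    rw [eventually_cofinite] at hf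
    refine hf.subset fun u hu => ?_
    have h2 : val (f.coeff u) - (dot (P.vert i) u : EReal) =
        ((-Real.log ‖f.coeff u₀‖ - dot (P.vert i) u₀ : ℝ) : EReal) := by
      rw [hu.2, ← h1, val, if_neg h0, EReal.coe_sub]
    simp [h2]
  · convert! Set.finite_empty
    ext u
    simp only [Set.mem_ofPred_eq, Set.mem_empty_iff_false, iff_false]
    exact fun hu => h ⟨u, hu⟩

/-- The initial form `in_{r_i}(f)`: the Laurent polynomial consisting of the terms of `f` whose
`val_{r_i}` equals `val_{r_i} (f)`. -/
noncomputable def initialForm (i : Fin P.numVert) (f : PolytopalAlgebra K P) :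
    AddMonoidAlgebra K (Mon n) :=
  open Classical in
  .ofCoeff (Finsupp.ofSupportFinite
    (fun u => if val (f.coeff u) - (dot (P.vert i) u : EReal) = valr (P.vert i) f
      then f.coeff u else 0)
    ((finite_initial i f).subset fun u hu => by
      simp only [Function.mem_support, ne_eq, ite_eq_right_iff, Classical.not_imp] at hu
      exact ⟨hu.2, hu.1⟩))

instance : Zero (PolytopalAlgebra K P) where
  zero := ⟨0, fun _ _ => .of_finite (by simp)⟩

instance : One (PolytopalAlgebra K P) where
  one := term 1 0

variable [IsUltrametricDist K]

instance : Add (PolytopalAlgebra K P) where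
  add f g := ⟨fun u => f.coeff u + g.coeff u,
    fun r hr => (f.converges r hr).add (g.converges r hr)⟩

instance : Neg (PolytopalAlgebra K P) where
  neg f := ⟨fun u => -f.coeff u, fun r hr => (f.converges r hr).neg⟩

/-- Multiplication of Laurent series: `(f g)_u = ∑_w f_w g_{u-w}`. -/
noncomputable instance : Mul (PolytopalAlgebra K P) where
  mul f g := ⟨conv f.coeff g.coeff, fun r hr => (f.converges r hr).conv (g.converges r hr)⟩

theorem coeff_mul (f g : PolytopalAlgebra K P) (u : Mon n) :
    (f * g).coeff u = ∑' w, f.coeff w * g.coeff (u - w) := rfl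

variable [CompleteSpace K]

noncomputable instance : CommRing (PolytopalAlgebra K P) :=
  CommRing.ofMinimalAxioms
    (fun f g h => PolytopalAlgebra.ext (funext fun _ => add_assoc _ _ _))
    (fun f => PolytopalAlgebra.ext (funext fun _ => zero_add _))
    (fun f => PolytopalAlgebra.ext (funext fun _ => neg_add_cancel _))
    (fun f g h => PolytopalAlgebra.ext
      (conv_assoc f.conv_at_vertex g.conv_at_vertex h.conv_at_vertex))
    (fun f g => PolytopalAlgebra.ext (conv_comm _ _))
    (fun f => PolytopalAlgebra.ext (funext fun u => by
      change ∑' w, (if w = 0 then (1 : K) else 0) * f.coeff (u - w) = f.coeff u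
      rw [tsum_eq_single 0 (fun w hw => by rw [if_neg hw, zero_mul])]
      simp))
    (fun f g h => PolytopalAlgebra.ext (funext fun u => by
      change ∑' w, f.coeff w * (g.coeff (u - w) + h.coeff (u - w)) =
        ∑' w, f.coeff w * g.coeff (u - w) + ∑' w, f.coeff w * h.coeff (u - w)
      simp only [mul_add]
      exact (summable_conv f.conv_at_vertex g.conv_at_vertex u).tsum_add
        (summable_conv f.conv_at_vertex h.conv_at_vertex u)))

end PolytopalAlgebra

/-! ### Vertex cones, conic decompositions and generalized monomial orders -/

section Cones

open PolytopalAlgebra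

/-- The vertex cone `V_i`: the monomials `X^α` with `i ∈ I_P(X^α)`, that is with
`val_P (X^α) = val_{r_i} (X^α)`. -/
def V (K : Type*) [NormedField K] {n : ℕ} (P : RatPolytope n) (i : Fin P.numVert) :
    Set (Mon n) :=
  {α | i ∈ IP (mono α : PolytopalAlgebra K P)}

/-- The set `V_{i,<}` of the monomials `X^α` with `min I_P(X^α) = i`. -/
def Vlt (K : Type*) [NormedField K] {n : ℕ} (P : RatPolytope n) (i : Fin P.numVert) :
    Set (Mon n) :=
  {α | (IP (mono α : PolytopalAlgebra K P)).min = (i : WithTop (Fin P.numVert))}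

/-- A conic decomposition of `S ⊆ T`: a finite family of finitely generated submonoids with union
`S`, each without nontrivial invertible elements and generating the group `T`. -/
structure IsConicDecomposition {n : ℕ} (S : Set (Mon n)) {ι : Type*}
    (C : ι → AddSubmonoid (Mon n)) : Prop where
  finite : Finite ι
  fg : ∀ i, (C i).FG
  pointed : ∀ i, ∀ u ∈ C i, -u ∈ C i → u = 0
  generates : ∀ i, AddSubgroup.closure (C i : Set (Mon n)) = ⊤
  iUnion_eq : ⋃ i, (C i : Set (Mon n)) = S

/-- A generalized monomial order on `T` for the family of cones `C`. -/
structure IsGMO {n : ℕ} (le : Mon n → Mon n → Prop) {ι : Type*}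
    (C : ι → AddSubmonoid (Mon n)) : Prop where
  refl : ∀ u, le u u
  trans : ∀ u v w, le u v → le v w → le u w
  antisymm : ∀ u v, le u v → le v u → u = v
  total : ∀ u v, le u v ∨ le v u
  one_le : ∀ u, le 0 u
  mul_lt_mul : ∀ r, ∀ i, ∀ s ∈ C i, ∀ t ∈ C i,
    (le r s ∧ r ≠ s) → (le (r + t) (s + t) ∧ r + t ≠ s + t)

end Cones

/-! ### Leading monomials of Laurent polynomials, cone by cone -/

section Laurent

variable {K : Type*} [NormedField K] {n : ℕ}

/-- The leading monomial of a nonzero Laurent polynomial: the greatest monomial of its support. -/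
noncomputable def lmL (le : Mon n → Mon n → Prop) (F : AddMonoidAlgebra K (Mon n)) : Mon n :=
  open Classical in
  if h : ∃ u ∈ F.coeff.support, ∀ w ∈ F.coeff.support, le w u then h.choose else 0

/-- The set of the monomials `t` such that `lm (t F)` lies in the cone `C`. -/
def coneSetL (le : Mon n → Mon n → Prop) (C : AddSubmonoid (Mon n))
    (F : AddMonoidAlgebra K (Mon n)) : Set (Mon n) :=
  {t | lmL le (AddMonoidAlgebra.single t 1 * F) ∈ C}

/-- The leading monomial of `F` for the cone `C`: the monomial `lm (t F) t⁻¹`, for any `t` such that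
`lm (t F)` lies in `C` (it does not depend on `t`, for a generalized monomial order). -/
noncomputable def lmConeL (le : Mon n → Mon n → Prop) (C : AddSubmonoid (Mon n))
    (F : AddMonoidAlgebra K (Mon n)) : Mon n :=
  open Classical in
  if h : (coneSetL le C F).Nonempty
  then lmL le (AddMonoidAlgebra.single h.choose 1 * F) - h.choose else 0

end Laurent

/-! ### Leading terms in `K{X;P}` and Gröbner bases -/

namespace PolytopalAlgebra

variable {K : Type*} [NormedField K] {n : ℕ} {P : RatPolytope n}

variable (P) in
/-- The preorder `a X^u ≤_P b X^v` on terms: compare first `val_P` (reversed), then `min I_P`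
(reversed), then the monomials for the generalized monomial order. -/
def termLE (le : Mon n → Mon n → Prop) (a : K) (u : Mon n) (b : K) (v : Mon n) : Prop :=
  let s : PolytopalAlgebra K P := term a u
  let t : PolytopalAlgebra K P := term b v
  valP t < valP s ∨
    (valP t = valP s ∧ (IP t).min < (IP s).min) ∨
    (valP t = valP s ∧ (IP t).min = (IP s).min ∧ le u v)

/-- The leading monomial of a nonzero series, for the preorder `≤_P` on its terms. -/
noncomputable def lm (le : Mon n → Mon n → Prop) (f : PolytopalAlgebra K P) : Mon n :=
  open Classical in
  if h : ∃ u, f.coeff u ≠ 0 ∧ ∀ w, f.coeff w ≠ 0 → termLE P le (f.coeff w) w (f.coeff u) u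
  then h.choose else 0

/-- The leading coefficient. -/
noncomputable def lc (le : Mon n → Mon n → Prop) (f : PolytopalAlgebra K P) : K :=
  f.coeff (lm le f)

/-- The leading term. -/
noncomputable def lt (le : Mon n → Mon n → Prop) (f : PolytopalAlgebra K P) :
    PolytopalAlgebra K P :=
  term (lc le f) (lm le f)

/-- `lm_{i,j}(f)`, where `C = T_{i,j}`: the leading monomial of `in_{r_i}(f)` for the cone `C`. -/
noncomputable def lmCone (le : Mon n → Mon n → Prop) (i : Fin P.numVert)
    (C : AddSubmonoid (Mon n)) (f : PolytopalAlgebra K P) : Mon n :=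
  lmConeL le C (initialForm i f)

/-- `lc_{i,j}(f)`, where `C = T_{i,j}`: the coefficient of `lm_{i,j}(f)` in `in_{r_i}(f)`. -/
noncomputable def lcCone (le : Mon n → Mon n → Prop) (i : Fin P.numVert)
    (C : AddSubmonoid (Mon n)) (f : PolytopalAlgebra K P) : K :=
  (initialForm i f).coeff (lmCone le i C f)

variable [IsUltrametricDist K]

/-- `T_{i,j}(f)`, where `C = T_{i,j}`: the monomials `t` with `lm (t f) ∈ T_{i,j} ∩ V_{i,<}`. -/
def coneSet (le : Mon n → Mon n → Prop) (i : Fin P.numVert)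
    (C : AddSubmonoid (Mon n)) (f : PolytopalAlgebra K P) : Set (Mon n) :=
  {t | lm le (mono t * f) ∈ (C : Set (Mon n)) ∩ Vlt K P i}

/-- The product set `lm_{i,j}(f) T_{i,j}(f)`, where `C = T_{i,j}`. -/
def lmConeSet (le : Mon n → Mon n → Prop) (i : Fin P.numVert)
    (C : AddSubmonoid (Mon n)) (f : PolytopalAlgebra K P) : Set (Mon n) :=
  {w | ∃ t ∈ coneSet le i C f, w = lmCone le i C f + t}

variable [CompleteSpace K]

/-- `G` is a Gröbner basis of the ideal `J`: it is a finite subset of `J \ {0}` such that the set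
of leading monomials of nonzero elements of `J` is the union of the `T_{i,j}(g) lm_{i,j}(g)`. -/
structure IsGroebnerBasis (le : Mon n → Mon n → Prop) {D : Fin P.numVert → Type*}
    (T : ∀ i, D i → AddSubmonoid (Mon n)) (J : Ideal (PolytopalAlgebra K P))
    (G : Set (PolytopalAlgebra K P)) : Prop where
  finite : G.Finite
  subset : G ⊆ (J : Set (PolytopalAlgebra K P)) \ {0}
  lm_eq : {u | ∃ f ∈ J, f ≠ 0 ∧ lm le f = u} = ⋃ g ∈ G, ⋃ i, ⋃ j, lmConeSet le i (T i j) g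

/-- The S-pair `S((i,j), f, g, v)`, where `C = T_{i,j}`. -/
noncomputable def sPair (le : Mon n → Mon n → Prop) (i : Fin P.numVert)
    (C : AddSubmonoid (Mon n)) (f g : PolytopalAlgebra K P) (v : Mon n) : PolytopalAlgebra K P :=
  term (lcCone le i C g) (v - lmCone le i C f) * f -
    term (lcCone le i C f) (v - lmCone le i C g) * g

/-! ### Multivariate division -/

/-- A state of the division algorithm by `m` divisors: the current dividend, the current quotients
and the current remainder. -/
structure DivState (K : Type*) [NormedField K] {n : ℕ} (P : RatPolytope n) (m : ℕ) where
  cur : PolytopalAlgebra K P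
  quot : Fin m → PolytopalAlgebra K P
  rem : PolytopalAlgebra K P

/-- The monomial `lm(f) / lm_{i,j}(g)`, by which the algorithm tries to multiply the divisor `g`. -/
noncomputable def factor (le : Mon n → Mon n → Prop) (i : Fin P.numVert)
    (C : AddSubmonoid (Mon n)) (f g : PolytopalAlgebra K P) : Mon n :=
  lm le f - lmCone le i C g

/-- One step of the division algorithm by `h_1, …, h_m`. If the dividend `f` is zero, the algorithm
has stopped. If `lm((lm(f) / lm_{i,j}(h_k)) h_k) = lm(f)` for some `i, j, k`, then for some such
`i, j, k` the dividend becomes `f - t h_k` and the `k`-th quotient is increased by `t`, where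
`t = lt(f) / lt_{i,j}(h_k)`. If there are no such `i, j, k`, then `lt(f)` is moved from the dividend
to the remainder. -/
inductive DivStep (le : Mon n → Mon n → Prop) {D : Fin P.numVert → Type*}
    (T : ∀ i, D i → AddSubmonoid (Mon n)) {m : ℕ} (h : Fin m → PolytopalAlgebra K P) :
    DivState K P m → DivState K P m → Prop
  | halt (q : Fin m → PolytopalAlgebra K P) (s : PolytopalAlgebra K P) :
      DivStep le T h ⟨0, q, s⟩ ⟨0, q, s⟩
  | reduce (f : PolytopalAlgebra K P) (q : Fin m → PolytopalAlgebra K P)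
      (s t : PolytopalAlgebra K P) (i : Fin P.numVert) (j : D i) (k : Fin m) (hf : f ≠ 0)
      (hlm : lm le (mono (factor le i (T i j) f (h k)) * h k) = lm le f)
      (ht : t = term (lc le f / lcCone le i (T i j) (h k)) (factor le i (T i j) f (h k))) :
      DivStep le T h ⟨f, q, s⟩ ⟨f - t * h k, Function.update q k (q k + t), s⟩
  | shift (f : PolytopalAlgebra K P) (q : Fin m → PolytopalAlgebra K P)
      (s : PolytopalAlgebra K P) (hf : f ≠ 0)
      (hlm : ∀ (i : Fin P.numVert) (j : D i) (k : Fin m),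
        lm le (mono (factor le i (T i j) f (h k)) * h k) ≠ lm le f) :
      DivStep le T h ⟨f, q, s⟩ ⟨f - lt le f, q, s + lt le f⟩

/-- A run of the division algorithm of `f` by `h_1, …, h_m`: an infinite sequence of steps starting
with zero quotients and zero remainder (constant once the dividend is zero). -/
structure IsDivRun (le : Mon n → Mon n → Prop) {D : Fin P.numVert → Type*}
    (T : ∀ i, D i → AddSubmonoid (Mon n)) {m : ℕ} (h : Fin m → PolytopalAlgebra K P)
    (f : PolytopalAlgebra K P) (run : ℕ → DivState K P m) : Prop where
  start : run 0 = ⟨f, 0, 0⟩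
  step : ∀ N, DivStep le T h (run N) (run (N + 1))

/-- The run has remainder `s`: its successive partial remainders converge to `s` for `val_P`. -/
def HasRemainder {m : ℕ} (run : ℕ → DivState K P m) (s : PolytopalAlgebra K P) : Prop :=
  Tendsto (fun N => valP ((run N).rem - s)) atTop (𝓝 ⊤)

end PolytopalAlgebra

/-- `U` is a generating system of the set of monomials `A`, as a module over the monoid `C`. -/
def GeneratesModule {n : ℕ} (C : AddSubmonoid (Mon n)) (U A : Set (Mon n)) : Prop :=
  A = {w | ∃ t ∈ C, ∃ u ∈ U, w = t + u}

end Polytopal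

/-! On terms, `val_P` is governed by the support function of the polytope: `exp (-val_P (a X^u)) =
‖a‖ exp (gauge P u)`, where `gauge P u` is the maximum of the `r_i · u`. The preorder on nonzero
terms is thus the lexicographic order on keys: this norm, then the index of the first maximizing
vertex (reversed), then the generalized monomial order. Multiplication by a monomial does not
preserve it in general, but it does when the larger monomial and the multiplier share a cone
`T_{i,j}` and `i` is the index of the larger monomial (`termKey_add_lt_add`). Leading terms
therefore behave classically, cone by cone (`lm_eq_lmCone_add`).

If `H` is a Gröbner basis, every dividend stays in `J`, so its leading term is always reducible and
nothing is ever moved to the remainder. Since runs always exist, a condition on all runs implies the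
same for some run.

For the remaining implication let `f ∈ J` be nonzero and let `ε` be the norm of its leading term. Up
to terms of norm less than `ε`, `f` is a finite sum of multiples `c X^u h_k`. If their leading terms
have distinct keys, the largest one cannot cancel, and `lm f` is the leading monomial of one of
these multiples, which is what is wanted. If two keys coincide, one multiple minus a rescaling of
the other is a term times an S-pair at a generator `v`. A truncated division with remainder zero
(`IsDivRun.exists_expansion`) rewrites this as smaller multiples plus a small error
(`exists_elimination`), and the process is repeated (`exists_lm_eq_of_elimination`).

Termination is the delicate point: the norms of terms may be dense in the positive reals, so a
strict decrease above `ε` proves nothing. But the terms of the translates of one series by a vertex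
cone leave a relative gap `ρ < 1` below a reference norm, uniformly in the translation, because the
vertices are rational (`eventually_gap`). Finitely many series are involved, so one `ρ` serves for
all. The number of factors `ρ` fitting above `ε`, followed by the monomial (well-ordered by
Dickson's lemma), is a well-founded rank, and the multiset of ranks decreases at each elimination.
-/

namespace Polytopal

/-! ### The gauge of a polytope -/

section Gauge

variable {n : ℕ}

/-- The maximum of `r_i · u` over the vertices `r_i`. -/
noncomputable def gauge (P : RatPolytope n) (u : Mon n) : ℝ :=
  Finset.univ.sup' ⟨⟨0, P.numVert_pos⟩, Finset.mem_univ _⟩ fun i => dot (P.vert i) u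

variable (P : RatPolytope n)

theorem dot_le_gauge (i : Fin P.numVert) (u : Mon n) : dot (P.vert i) u ≤ gauge P u :=
  Finset.le_sup' (fun i => dot (P.vert i) u) (Finset.mem_univ i)

theorem exists_dot_eq_gauge (u : Mon n) : ∃ i, dot (P.vert i) u = gauge P u := by
  obtain ⟨i, -, hi⟩ := Finset.exists_mem_eq_sup' (s := Finset.univ)
    ⟨⟨0, P.numVert_pos⟩, Finset.mem_univ _⟩ fun i => dot (P.vert i) u
  exact ⟨i, hi.symm⟩

theorem gauge_add_le (u v : Mon n) : gauge P (u + v) ≤ gauge P u + gauge P v := by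
  obtain ⟨i, hi⟩ := exists_dot_eq_gauge P (u + v)
  rw [← hi, dot_add]
  exact add_le_add (dot_le_gauge P i u) (dot_le_gauge P i v)

/-- A half-space containing the vertices contains their convex hull. Hence `val_P` of a term is
computed at the vertices alone. -/
theorem dot_le_gauge_of_mem_points {r : Fin n → ℚ} (hr : r ∈ P.points) (u : Mon n) :
    dot r u ≤ gauge P u := by
  let φ : (Fin n → ℝ) → ℝ := fun x => ∑ k, x k * (u k : ℝ)
  have hφ : IsLinearMap ℝ φ :=
    ⟨fun x y => by simp [φ, add_mul, Finset.sum_add_distrib],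
      fun c x => by simp [φ, Finset.mul_sum, mul_assoc]⟩
  have hc : Convex ℝ {x | φ x ≤ gauge P u} := convex_halfSpace_le hφ _
  have hsub : P.carrier ⊆ {x | φ x ≤ gauge P u} := by
    refine convexHull_min ?_ hc
    rintro _ ⟨i, rfl⟩
    exact dot_le_gauge P i u
  exact hsub hr

/-- The smallest index of a vertex at which the gauge is attained. -/
noncomputable def vertexIndex (u : Mon n) : Fin P.numVert :=
  open Classical in
  (Finset.univ.filter fun i => dot (P.vert i) u = gauge P u).min' (by
    obtain ⟨i, hi⟩ := exists_dot_eq_gauge P u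
    exact ⟨i, by simpa using hi⟩)

theorem dot_vertexIndex (u : Mon n) : dot (P.vert (vertexIndex P u)) u = gauge P u := by
  classical
  have := Finset.min'_mem (Finset.univ.filter fun i => dot (P.vert i) u = gauge P u) (by
    obtain ⟨i, hi⟩ := exists_dot_eq_gauge P u
    exact ⟨i, by simpa using hi⟩)
  unfold vertexIndex
  exact (Finset.mem_filter.mp this).2

variable {P} in
theorem vertexIndex_le {i : Fin P.numVert} {u : Mon n} (h : dot (P.vert i) u = gauge P u) :
    vertexIndex P u ≤ i :=
  Finset.min'_le _ _ (by simpa using h)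

variable {P} in
theorem gauge_add_eq {w t : Mon n} {i : Fin P.numVert} (hw : dot (P.vert i) w = gauge P w)
    (ht : dot (P.vert i) t = gauge P t) : gauge P (w + t) = gauge P w + gauge P t := by
  refine le_antisymm (gauge_add_le P w t) ?_
  rw [← hw, ← ht, ← dot_add]
  exact dot_le_gauge P i _

variable {P} in
theorem dot_eq_of_gauge_add_eq {w t : Mon n} {i : Fin P.numVert}
    (h : gauge P (w + t) = gauge P w + gauge P t) (hi : dot (P.vert i) (w + t) = gauge P (w + t)) :
    dot (P.vert i) w = gauge P w := by
  rw [dot_add] at hi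
  linarith [dot_le_gauge P i w, dot_le_gauge P i t]

variable {P} in
theorem vertexIndex_le_add {w t : Mon n} (h : gauge P (w + t) = gauge P w + gauge P t) :
    vertexIndex P w ≤ vertexIndex P (w + t) :=
  vertexIndex_le (dot_eq_of_gauge_add_eq h (dot_vertexIndex P _))

variable {P} in
-- The gauge is additive here, and additivity forces every maximizing vertex of `w + t` to maximize
-- `w` as well, so no smaller index can appear.
theorem vertexIndex_add {w t : Mon n} (ht : dot (P.vert (vertexIndex P w)) t = gauge P t) :
    vertexIndex P (w + t) = vertexIndex P w := by
  have h := gauge_add_eq (dot_vertexIndex P w) ht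
  refine le_antisymm (vertexIndex_le ?_) (vertexIndex_le_add h)
  rw [dot_add, dot_vertexIndex, ht, h]

end Gauge

/-! ### Valuations of terms -/

section Terms

variable {K : Type*} [NormedField K] {n : ℕ} {P : RatPolytope n}

theorem val_zero : val (0 : K) = ⊤ := by simp [val]

theorem val_of_ne_zero {a : K} (ha : a ≠ 0) : val a = ((-Real.log ‖a‖ : ℝ) : EReal) := by
  simp [val, ha]

theorem val_sub_le_iff {a b : K} (ha : a ≠ 0) (c d : ℝ) :
    val a - (c : EReal) ≤ val b - (d : EReal) ↔ ‖b‖ * Real.exp d ≤ ‖a‖ * Real.exp c := by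
  rw [val_of_ne_zero ha, ← EReal.coe_sub]
  rw [← not_iff_not, not_le, not_le]
  by_cases hb : b = 0
  · simp [hb, val_zero]
    positivity
  rw [val_of_ne_zero hb, ← EReal.coe_sub, EReal.coe_lt_coe_iff]
  have ha' := norm_pos_iff.mpr ha
  have hb' := norm_pos_iff.mpr hb
  nth_rewrite 2 [← Real.exp_log ha', ← Real.exp_log hb']
  rw [← Real.exp_add, ← Real.exp_add, Real.exp_lt_exp]
  constructor <;> intro h <;> linarith

namespace PolytopalAlgebra

@[simp] theorem coeff_zero (u : Mon n) : (0 : PolytopalAlgebra K P).coeff u = 0 := rfl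

theorem ne_zero_iff {f : PolytopalAlgebra K P} : f ≠ 0 ↔ ∃ u, f.coeff u ≠ 0 := by
  rw [← not_iff_not]
  push Not
  exact ⟨fun h u => by simp [h], fun h => PolytopalAlgebra.ext (funext h)⟩

theorem coeff_term (a : K) (u w : Mon n) :
    (term a u : PolytopalAlgebra K P).coeff w = if w = u then a else 0 := rfl

theorem valr_term (r : Fin n → ℚ) (a : K) (u : Mon n) :
    valr r (term a u : PolytopalAlgebra K P) = val a - (dot r u : EReal) := by
  refine le_antisymm ((iInf_le _ u).trans (by simp [coeff_term])) (le_iInf fun w => ?_)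
  rw [coeff_term]
  split_ifs with h
  · rw [h]
  · rw [val_zero, EReal.top_sub_coe]
    exact le_top

theorem valP_term (a : K) (u : Mon n) :
    valP (term a u : PolytopalAlgebra K P) = val a - (gauge P u : EReal) := by
  simp only [valP, valr_term]
  apply le_antisymm
  · obtain ⟨i, hi⟩ := exists_dot_eq_gauge P u
    rw [← hi]
    exact iInf₂_le _ (P.vert_mem i)
  · refine le_iInf₂ fun r hr => EReal.sub_le_sub le_rfl ?_
    exact_mod_cast dot_le_gauge_of_mem_points P hr u

theorem mem_IP_term {a : K} (ha : a ≠ 0) {u : Mon n} {i : Fin P.numVert} :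
    i ∈ IP (term a u : PolytopalAlgebra K P) ↔ dot (P.vert i) u = gauge P u := by
  simp only [IP, Finset.mem_filter, Finset.mem_univ, true_and, valP_term, valr_term,
    val_of_ne_zero ha, ← EReal.coe_sub, EReal.coe_eq_coe_iff]
  constructor <;> intro h <;> linarith

theorem min_IP_term {a : K} (ha : a ≠ 0) (u : Mon n) :
    (IP (term a u : PolytopalAlgebra K P)).min = (vertexIndex P u : WithTop (Fin P.numVert)) := by
  apply le_antisymm
  · exact Finset.min_le ((mem_IP_term ha).mpr (dot_vertexIndex P u))
  · refine Finset.le_min fun i hi => ?_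
    exact_mod_cast vertexIndex_le ((mem_IP_term ha).mp hi)

end PolytopalAlgebra

theorem mem_V_iff {i : Fin P.numVert} {u : Mon n} :
    u ∈ V K P i ↔ dot (P.vert i) u = gauge P u :=
  PolytopalAlgebra.mem_IP_term one_ne_zero

theorem mem_Vlt_iff {i : Fin P.numVert} {u : Mon n} :
    u ∈ Vlt K P i ↔ vertexIndex P u = i := by
  change (PolytopalAlgebra.IP (PolytopalAlgebra.mono u : PolytopalAlgebra K P)).min = _ ↔ _
  rw [PolytopalAlgebra.min_IP_term one_ne_zero, WithTop.coe_inj]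

end Terms

/-! ### The order on terms -/

section Order

variable {n : ℕ} {le : Mon n → Mon n → Prop} {ι : Type*} {C : ι → AddSubmonoid (Mon n)}

/-- The monomials, linearly ordered by a generalized monomial order. -/
def OrdMon (_ : IsGMO le C) : Type := Mon n

noncomputable instance (hle : IsGMO le C) : LinearOrder (OrdMon hle) where
  le := le
  le_refl := hle.refl
  le_trans := hle.trans
  le_antisymm := hle.antisymm
  le_total := hle.total
  toDecidableLE := Classical.decRel _

/-- A monomial as an element of the linear order. -/
def toOrd (hle : IsGMO le C) (u : Mon n) : OrdMon hle := u

theorem toOrd_le (hle : IsGMO le C) {u v : Mon n} : toOrd hle u ≤ toOrd hle v ↔ le u v := Iff.rfl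

theorem toOrd_inj (hle : IsGMO le C) {u v : Mon n} : toOrd hle u = toOrd hle v ↔ u = v := Iff.rfl

theorem toOrd_lt (hle : IsGMO le C) {u v : Mon n} :
    toOrd hle u < toOrd hle v ↔ le u v ∧ u ≠ v := by
  rw [lt_iff_le_and_ne, toOrd_le, Ne, toOrd_inj]

theorem toOrd_add_lt (hle : IsGMO le C) {u s t : Mon n} {i : ι} (hs : s ∈ C i) (ht : t ∈ C i)
    (h : toOrd hle u < toOrd hle s) : toOrd hle (u + t) < toOrd hle (s + t) := by
  rw [toOrd_lt] at *
  exact hle.mul_lt_mul u i s hs t ht h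

/-- This is `1 ≤ t` multiplied by `s` inside a common cone. -/
theorem toOrd_add_le (hle : IsGMO le C) {s t : Mon n} {i : ι} (hs : s ∈ C i) (ht : t ∈ C i) :
    toOrd hle s ≤ toOrd hle (s + t) := by
  rcases eq_or_ne t 0 with rfl | h0
  · simp
  · have : toOrd hle 0 < toOrd hle t := (toOrd_lt hle).mpr ⟨hle.one_le t, h0.symm⟩
    have := toOrd_add_lt hle ht hs this
    rw [zero_add, add_comm] at this
    exact this.le

/-- By Dickson's lemma, a generalized monomial order is a well-order. -/
theorem wellFoundedLT_ordMon (hle : IsGMO le C) [Finite ι] (hfg : ∀ i, (C i).FG)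
    (hcov : ∀ u, ∃ i, u ∈ C i) : WellFoundedLT (OrdMon hle) := by
  have hC : ∀ i, ({u : OrdMon hle | (show Mon n from u) ∈ C i}).IsPWO := by
    intro i
    -- A finite generating system parametrizes the cone by `ℕ^k`. The componentwise order there is a
    -- well-quasi-order, and it passes to the image under the monotone map `φ`.
    obtain ⟨k, φ, hφ⟩ := (Submodule.fg_iff_exists_fin_linearMap ℕ (Mon n)).mp
      ((Submodule.fg_iff_addSubmonoid_fg (C i).toNatSubmodule).mpr (by simpa using hfg i))
    have hmem : ∀ x, φ x ∈ C i := fun x => by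
      have : φ x ∈ LinearMap.range φ := ⟨x, rfl⟩
      rw [hφ] at this
      exact this
    have hmono : Monotone fun x => toOrd hle (φ x) := by
      intro x y hxy
      obtain ⟨z, rfl⟩ := exists_add_of_le hxy
      simp only [map_add]
      exact toOrd_add_le hle (hmem x) (hmem z)
    refine ((Set.isPWO_of_wellQuasiOrderedLE Set.univ).image_of_monotone hmono).mono ?_
    intro u hu
    have : (show Mon n from u) ∈ LinearMap.range φ := by rw [hφ]; exact hu
    obtain ⟨x, hx⟩ := this
    exact ⟨x, trivial, hx⟩
  cases nonempty_fintype ι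
  have h : (⋃ i ∈ (Finset.univ : Finset ι), {u : OrdMon hle | (show Mon n from u) ∈ C i}).IsPWO :=
    (Finset.isPWO_bUnion _).mpr fun i _ => hC i
  have huniv : (Set.univ : Set (OrdMon hle)).IsPWO := h.mono fun u _ => by
    obtain ⟨i, hi⟩ := hcov u
    exact Set.mem_biUnion (Finset.mem_univ i) hi
  exact ⟨Set.wellFoundedOn_univ.mp huniv.isWF⟩

/-- The norm `exp (-val_P (a X^u))` of a term. -/
noncomputable def termNorm {K : Type*} [NormedField K] (P : RatPolytope n) (a : K) (u : Mon n) : ℝ :=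
  ‖a‖ * Real.exp (gauge P u)

/-- The key by which monomials of equal `val_P` are compared. -/
noncomputable def monKey (hle : IsGMO le C) (P : RatPolytope n) (u : Mon n) :
    (Fin P.numVert)ᵒᵈ ×ₗ OrdMon hle :=
  toLex (OrderDual.toDual (vertexIndex P u), toOrd hle u)

/-- The key by which terms are compared. -/
noncomputable def termKey {K : Type*} [NormedField K] (hle : IsGMO le C) (P : RatPolytope n)
    (a : K) (u : Mon n) : ℝ ×ₗ ((Fin P.numVert)ᵒᵈ ×ₗ OrdMon hle) :=
  toLex (termNorm P a u, monKey hle P u)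

variable {K : Type*} [NormedField K] {P : RatPolytope n} (hle : IsGMO le C)

theorem monKey_injective : Function.Injective (monKey hle P) := fun u v h => by
  simp only [monKey, EmbeddingLike.apply_eq_iff_eq, Prod.mk.injEq, toOrd_inj] at h
  exact h.2

theorem termNorm_nonneg (a : K) (u : Mon n) : 0 ≤ termNorm P a u := by
  unfold termNorm; positivity

theorem termNorm_pos {a : K} (ha : a ≠ 0) (u : Mon n) : 0 < termNorm P a u :=
  mul_pos (norm_pos_iff.mpr ha) (Real.exp_pos _)

theorem termNorm_mul (c a : K) (u : Mon n) : termNorm P (c * a) u = ‖c‖ * termNorm P a u := by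
  simp [termNorm, mul_assoc]

theorem termNorm_le_iff {a b : K} {u : Mon n} :
    termNorm P a u ≤ termNorm P b u ↔ ‖a‖ ≤ ‖b‖ :=
  mul_le_mul_iff_left₀ (Real.exp_pos _)

theorem termNorm_add_le (a : K) (u t : Mon n) :
    termNorm P a (u + t) ≤ termNorm P a u * Real.exp (gauge P t) := by
  rw [termNorm, termNorm, mul_assoc, ← Real.exp_add]
  gcongr
  exact gauge_add_le P u t

theorem termNorm_add_eq (a : K) {u t : Mon n} (h : gauge P (u + t) = gauge P u + gauge P t) :
    termNorm P a (u + t) = termNorm P a u * Real.exp (gauge P t) := by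
  rw [termNorm, termNorm, mul_assoc, ← Real.exp_add, h]

variable {hle}

theorem termKey_le_iff {a b : K} {u v : Mon n} : termKey hle P a u ≤ termKey hle P b v ↔
    termNorm P a u < termNorm P b v ∨
      (termNorm P a u = termNorm P b v ∧ monKey hle P u ≤ monKey hle P v) :=
  Prod.Lex.toLex_le_toLex

theorem termKey_lt_iff {a b : K} {u v : Mon n} : termKey hle P a u < termKey hle P b v ↔
    termNorm P a u < termNorm P b v ∨
      (termNorm P a u = termNorm P b v ∧ monKey hle P u < monKey hle P v) :=
  Prod.Lex.toLex_lt_toLex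

theorem monKey_lt_iff {u v : Mon n} : monKey hle P u < monKey hle P v ↔
    vertexIndex P v < vertexIndex P u ∨
      (vertexIndex P u = vertexIndex P v ∧ toOrd hle u < toOrd hle v) :=
  Prod.Lex.toLex_lt_toLex

theorem monKey_le_iff {u v : Mon n} : monKey hle P u ≤ monKey hle P v ↔
    vertexIndex P v < vertexIndex P u ∨
      (vertexIndex P u = vertexIndex P v ∧ toOrd hle u ≤ toOrd hle v) :=
  Prod.Lex.toLex_le_toLex

theorem termNorm_le_of_termKey_le {a b : K} {u v : Mon n}
    (h : termKey hle P a u ≤ termKey hle P b v) : termNorm P a u ≤ termNorm P b v := by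
  rcases termKey_le_iff.mp h with h | h
  exacts [h.le, h.1.le]

theorem termKey_lt_of_termNorm_lt {a b : K} {u v : Mon n}
    (h : termNorm P a u < termNorm P b v) : termKey hle P a u < termKey hle P b v :=
  termKey_lt_iff.mpr (.inl h)

theorem termKey_le_same_iff {a b : K} {u : Mon n} :
    termKey hle P a u ≤ termKey hle P b u ↔ ‖a‖ ≤ ‖b‖ := by
  rw [termKey_le_iff, ← termNorm_le_iff (P := P) (u := u)]
  simp [le_iff_lt_or_eq]

theorem termKey_lt_same_iff {a b : K} {u : Mon n} :
    termKey hle P a u < termKey hle P b u ↔ ‖a‖ < ‖b‖ := by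
  rw [← not_le, termKey_le_same_iff, not_le]

theorem eq_of_termKey_eq {a b : K} {u v : Mon n} (h : termKey hle P a u = termKey hle P b v) :
    u = v ∧ ‖a‖ = ‖b‖ := by
  simp only [termKey, EmbeddingLike.apply_eq_iff_eq, Prod.mk.injEq] at h
  have huv := monKey_injective hle h.2
  subst huv
  exact ⟨rfl, mul_right_cancel₀ (Real.exp_pos _).ne' h.1⟩

theorem termKey_neg (a : K) (u : Mon n) : termKey hle P (-a) u = termKey hle P a u := by
  simp [termKey, termNorm]

theorem termKey_add_le [IsUltrametricDist K] (a b : K) (u : Mon n) :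
    termKey hle P (a + b) u ≤ max (termKey hle P a u) (termKey hle P b u) := by
  rw [le_max_iff, termKey_le_same_iff, termKey_le_same_iff, ← le_max_iff]
  exact IsUltrametricDist.norm_add_le_max a b

theorem termKey_sub_le [IsUltrametricDist K] (a b : K) (u : Mon n) :
    termKey hle P (a - b) u ≤ max (termKey hle P a u) (termKey hle P b u) := by
  rw [sub_eq_add_neg, ← termKey_neg b]
  exact termKey_add_le _ _ _

theorem termKey_mul_lt_mul {a b c : K} (hc : c ≠ 0) {u v : Mon n}
    (h : termKey hle P a u < termKey hle P b v) :
    termKey hle P (c * a) u < termKey hle P (c * b) v := by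
  have hc' := norm_pos_iff.mpr hc
  rw [termKey_lt_iff] at *
  rw [termNorm_mul, termNorm_mul, mul_lt_mul_iff_right₀ hc']
  exact h.imp_right (And.imp_left (congrArg _))

theorem termKey_mul_le_mul {a b c : K} (hc : c ≠ 0) {u v : Mon n}
    (h : termKey hle P a u ≤ termKey hle P b v) :
    termKey hle P (c * a) u ≤ termKey hle P (c * b) v := by
  rcases h.eq_or_lt with h | h
  · obtain ⟨rfl, hab⟩ := eq_of_termKey_eq h
    rw [termKey_le_same_iff, norm_mul, norm_mul, hab]
  · exact (termKey_mul_lt_mul hc h).le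

/-- Multiplication by `X^t` scales the norm at `w` by exactly `exp (gauge P t)` and the norm at `u`
by at most that. If the norms still tie afterwards, the gauge is additive at `u` too, so the index
at `u` can only grow while the index at `w` is unchanged. The last comparison is then the axiom of
generalized monomial orders in the common cone. -/
theorem termKey_add_lt_add {a b : K} (hb : b ≠ 0) {u w t : Mon n} {x : ι}
    (hw : w ∈ C x) (ht : t ∈ C x)
    (hdot : dot (P.vert (vertexIndex P w)) t = gauge P t)
    (h : termKey hle P a u < termKey hle P b w) :
    termKey hle P a (u + t) < termKey hle P b (w + t) := by
  have hgw := gauge_add_eq (dot_vertexIndex P w) hdot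
  have h1 := termNorm_add_le (P := P) a u t
  have h2 := termNorm_add_eq b hgw
  have he := Real.exp_pos (gauge P t)
  rw [termKey_lt_iff] at h ⊢
  rcases h with h | ⟨h, hk⟩
  · left
    rw [h2]
    exact h1.trans_lt (mul_lt_mul_of_pos_right h he)
  rw [h] at h1
  rw [← h2] at h1
  rcases h1.lt_or_eq with h1 | h1
  · exact .inl h1
  refine .inr ⟨h1, ?_⟩
  have ha : a ≠ 0 := by
    rintro rfl
    exact (termNorm_pos (P := P) hb w).ne (by simpa [termNorm] using h)
  -- The tie in norm leaves no slack in the subadditivity of the gauge.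
  have hgu : gauge P (u + t) = gauge P u + gauge P t := by
    have h3 : termNorm P a (u + t) = termNorm P a u * Real.exp (gauge P t) := by
      rw [h1, h2, h]
    rw [termNorm, termNorm, mul_assoc, ← Real.exp_add] at h3
    exact Real.exp_injective (mul_left_cancel₀ (norm_ne_zero_iff.mpr ha) h3)
  rw [monKey_lt_iff] at hk ⊢
  rw [vertexIndex_add hdot]
  have h4 := vertexIndex_le_add hgu
  rcases hk with hk | ⟨hi, hk⟩
  · exact .inl (hk.trans_le h4)
  · rw [hi] at h4
    rcases h4.lt_or_eq with h4 | h4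
    · exact .inl h4
    · exact .inr ⟨h4.symm, toOrd_add_lt hle hw ht hk⟩

end Order

end Polytopal

namespace Polytopal

/-! ### Leading monomials of Laurent polynomials -/

section Laurent

theorem exists_sub_of_closure_eq_top {n : ℕ} {C : AddSubmonoid (Mon n)}
    (hC : AddSubgroup.closure (C : Set (Mon n)) = ⊤) (u : Mon n) :
    ∃ c ∈ C, ∃ d ∈ C, u = c - d := by
  have hu : u ∈ AddSubgroup.closure (C : Set (Mon n)) := hC ▸ AddSubgroup.mem_top u
  induction hu using AddSubgroup.closure_induction with
  | mem x hx => exact ⟨x, hx, 0, C.zero_mem, (sub_zero x).symm⟩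
  | zero => exact ⟨0, C.zero_mem, 0, C.zero_mem, (sub_zero 0).symm⟩
  | add x y _ _ hx hy =>
    obtain ⟨a, ha, b, hb, rfl⟩ := hx
    obtain ⟨c, hc, d, hd, rfl⟩ := hy
    exact ⟨a + c, C.add_mem ha hc, b + d, C.add_mem hb hd, by abel⟩
  | neg x _ hx =>
    obtain ⟨a, ha, b, hb, rfl⟩ := hx
    exact ⟨b, hb, a, ha, by abel⟩

/-- As with common denominators: if `t` already works for `s`, writing `a + t = c - d` with `c`, `d`
in the cone shows that the further shift by `d` also brings `a` into it. -/
theorem exists_forall_add_mem {n : ℕ} {C : AddSubmonoid (Mon n)}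
    (hC : AddSubgroup.closure (C : Set (Mon n)) = ⊤) (s : Finset (Mon n)) :
    ∃ t, ∀ u ∈ s, u + t ∈ C := by
  classical
  induction s using Finset.induction_on with
  | empty => exact ⟨0, by simp⟩
  | insert a s _ ih =>
    obtain ⟨t, ht⟩ := ih
    obtain ⟨c, hc, d, hd, h⟩ := exists_sub_of_closure_eq_top hC (a + t)
    refine ⟨t + d, fun u hu => ?_⟩
    rcases Finset.mem_insert.mp hu with rfl | hu
    · rw [← add_assoc, h, sub_add_cancel]
      exact hc
    · rw [← add_assoc]
      exact C.add_mem (ht u hu) hd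

variable {K : Type*} [NormedField K] {n : ℕ} {le : Mon n → Mon n → Prop} {ι : Type*}
  {C : ι → AddSubmonoid (Mon n)}

theorem lmL_eq (hle : IsGMO le C) {F : AddMonoidAlgebra K (Mon n)} {u : Mon n}
    (hu : F.coeff u ≠ 0) (h : ∀ w, F.coeff w ≠ 0 → le w u) : lmL le F = u := by
  have hex : ∃ u ∈ F.coeff.support, ∀ w ∈ F.coeff.support, le w u :=
    ⟨u, by simpa using hu, fun w hw => h w (by simpa using hw)⟩
  rw [lmL, dif_pos hex]
  obtain ⟨h1, h2⟩ := hex.choose_spec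
  exact hle.antisymm _ _ (h _ (by simpa using h1)) (h2 _ (by simpa using hu))

theorem lmL_spec (hle : IsGMO le C) {F : AddMonoidAlgebra K (Mon n)} (hF : ∃ u, F.coeff u ≠ 0) :
    F.coeff (lmL le F) ≠ 0 ∧ ∀ w, F.coeff w ≠ 0 → le w (lmL le F) := by
  obtain ⟨u, hu, hmax⟩ := Finset.exists_max_image F.coeff.support (toOrd hle)
    (by obtain ⟨u, hu⟩ := hF; exact ⟨u, by simpa using hu⟩)
  have hu' : F.coeff u ≠ 0 := by simpa using hu
  have hmax' : ∀ w, F.coeff w ≠ 0 → le w u := fun w hw => hmax w (by simpa using hw)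
  rw [lmL_eq hle hu' hmax']
  exact ⟨hu', hmax'⟩

theorem coeff_single_one_mul (t u : Mon n) (F : AddMonoidAlgebra K (Mon n)) :
    (AddMonoidAlgebra.single t 1 * F).coeff u = F.coeff (u - t) := by
  rw [AddMonoidAlgebra.coeff_single_mul_apply, one_mul, neg_add_eq_sub]

theorem lmL_single_mul_spec (hle : IsGMO le C) {F : AddMonoidAlgebra K (Mon n)}
    (hF : ∃ u, F.coeff u ≠ 0) (t : Mon n) :
    F.coeff (lmL le (AddMonoidAlgebra.single t 1 * F) - t) ≠ 0 ∧
      ∀ w, F.coeff w ≠ 0 → le (w + t) (lmL le (AddMonoidAlgebra.single t 1 * F)) := by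
  obtain ⟨u, hu⟩ := hF
  obtain ⟨h1, h2⟩ := lmL_spec hle (F := AddMonoidAlgebra.single t 1 * F)
    ⟨u + t, by rwa [coeff_single_one_mul, add_sub_cancel_right]⟩
  refine ⟨by rwa [coeff_single_one_mul] at h1, fun w hw => h2 _ ?_⟩
  rwa [coeff_single_one_mul, add_sub_cancel_right]

/-- Write `s - t = c - d` with `c`, `d` in the cone. If the two candidates differed, maximality of
`a` and of `b` would give strict inequalities whose shifts by `d` and by `c` read `b + c < a + d`
and `a + d < b + c`. -/
theorem lmL_sub_eq_of_mem (hle : IsGMO le C) {x : ι}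
    (hC : AddSubgroup.closure (C x : Set (Mon n)) = ⊤) {F : AddMonoidAlgebra K (Mon n)}
    (hF : ∃ u, F.coeff u ≠ 0) {s t : Mon n} (hs : s ∈ coneSetL le (C x) F)
    (ht : t ∈ coneSetL le (C x) F) :
    lmL le (AddMonoidAlgebra.single s 1 * F) - s = lmL le (AddMonoidAlgebra.single t 1 * F) - t := by
  obtain ⟨hs1, hs2⟩ := lmL_single_mul_spec hle hF s
  obtain ⟨ht1, ht2⟩ := lmL_single_mul_spec hle hF t
  change lmL le (AddMonoidAlgebra.single s 1 * F) ∈ C x at hs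
  change lmL le (AddMonoidAlgebra.single t 1 * F) ∈ C x at ht
  set a := lmL le (AddMonoidAlgebra.single s 1 * F)
  set b := lmL le (AddMonoidAlgebra.single t 1 * F)
  by_contra hne
  obtain ⟨c, hc, d, hd, hcd⟩ := exists_sub_of_closure_eq_top hC (s - t)
  have h1 : toOrd hle (b - t + s) < toOrd hle a :=
    (toOrd_lt hle).mpr ⟨hs2 _ ht1, fun h => hne (by rw [← h]; abel)⟩
  have h2 : toOrd hle (a - s + t) < toOrd hle b :=
    (toOrd_lt hle).mpr ⟨ht2 _ hs1, fun h => hne (by rw [← h]; abel)⟩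
  have h3 := toOrd_add_lt hle hs hd h1
  have h4 := toOrd_add_lt hle ht hc h2
  have e1 : b - t + s + d = b + c := by
    have : s = c - d + t := by rw [← hcd]; abel
    rw [this]; abel
  have e2 : a - s + t + c = a + d := by
    have : s = c - d + t := by rw [← hcd]; abel
    rw [this]; abel
  rw [e1] at h3
  rw [e2] at h4
  exact lt_asymm h3 h4

theorem lmConeL_eq (hle : IsGMO le C) {x : ι}
    (hC : AddSubgroup.closure (C x : Set (Mon n)) = ⊤) {F : AddMonoidAlgebra K (Mon n)}
    (hF : ∃ u, F.coeff u ≠ 0) {t : Mon n} (ht : t ∈ coneSetL le (C x) F) :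
    lmConeL le (C x) F = lmL le (AddMonoidAlgebra.single t 1 * F) - t := by
  have hne : (coneSetL le (C x) F).Nonempty := ⟨t, ht⟩
  rw [lmConeL, dif_pos hne]
  exact lmL_sub_eq_of_mem hle hC hF hne.choose_spec ht

theorem coeff_lmConeL_ne_zero (hle : IsGMO le C) {x : ι}
    (hC : AddSubgroup.closure (C x : Set (Mon n)) = ⊤) {F : AddMonoidAlgebra K (Mon n)}
    (hF : ∃ u, F.coeff u ≠ 0) : F.coeff (lmConeL le (C x) F) ≠ 0 := by
  -- A `t` moving the whole support into the cone moves the leading monomial there, so the default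
  -- value in the definition is not used.
  obtain ⟨t, ht⟩ := exists_forall_add_mem hC F.coeff.support
  have h := (lmL_single_mul_spec hle hF t).1
  have hmem : t ∈ coneSetL le (C x) F := by
    have := ht _ (Finsupp.mem_support_iff.mpr h)
    rwa [sub_add_cancel] at this
  rwa [lmConeL_eq hle hC hF hmem]

end Laurent

/-! ### Leading terms -/

namespace PolytopalAlgebra

variable {K : Type*} [NormedField K] {n : ℕ} {P : RatPolytope n}

section Leading

variable {le : Mon n → Mon n → Prop} {ι : Type*} {C : ι → AddSubmonoid (Mon n)}

/-- The norm of each term is attained at one of finitely many vertices, so it is bounded by the sum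
of the vertex norms, each of which tends to zero. -/
theorem tendsto_termNorm (f : PolytopalAlgebra K P) :
    Tendsto (fun u => termNorm P (f.coeff u) u) cofinite (𝓝 0) := by
  have h := tendsto_finsetSum Finset.univ fun (i : Fin P.numVert) _ =>
    (convergesAt_iff _ _).mp (f.converges _ (P.vert_mem i))
  rw [Finset.sum_const_zero] at h
  refine squeeze_zero (fun u => termNorm_nonneg _ _) (fun u => ?_) h
  obtain ⟨i, hi⟩ := exists_dot_eq_gauge P u
  rw [termNorm, ← hi]
  exact Finset.single_le_sum
    (f := fun i => ‖f.coeff u‖ * Real.exp (dot (P.vert i) u)) (fun _ _ => by positivity)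
    (Finset.mem_univ i)

theorem finite_le_termNorm (f : PolytopalAlgebra K P) {ε : ℝ} (hε : 0 < ε) :
    {u | ε ≤ termNorm P (f.coeff u) u}.Finite := by
  have h := (tendsto_termNorm f).eventually_lt_const hε
  rw [eventually_cofinite] at h
  simpa using h

theorem exists_termNorm_le (f : PolytopalAlgebra K P) :
    ∃ B, 0 < B ∧ ∀ u, termNorm P (f.coeff u) u ≤ B := by
  obtain ⟨B, hB⟩ := (tendsto_termNorm f).bddAbove_range_of_cofinite
  exact ⟨max B 1, by positivity, fun u => (hB ⟨u, rfl⟩).trans (le_max_left _ _)⟩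

theorem termLE_iff (hle : IsGMO le C) {a b : K} (ha : a ≠ 0) (hb : b ≠ 0) {u v : Mon n} :
    termLE P le a u b v ↔ termKey hle P a u ≤ termKey hle P b v := by
  have hlt : ∀ {a b : K} (_ : a ≠ 0) (_ : b ≠ 0) {u v : Mon n},
      valP (term b v : PolytopalAlgebra K P) < valP (term a u : PolytopalAlgebra K P) ↔
        termNorm P a u < termNorm P b v := fun ha hb u v => by
    rw [← not_le, ← not_le, valP_term, valP_term, val_sub_le_iff ha]
    rfl
  have heq : valP (term b v : PolytopalAlgebra K P) = valP (term a u : PolytopalAlgebra K P) ↔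
      termNorm P a u = termNorm P b v := by
    have h1 := hlt ha hb (u := u) (v := v)
    have h2 := hlt hb ha (u := v) (v := u)
    rw [← not_iff_not, ← Ne, ← Ne, lt_or_lt_iff_ne.symm, lt_or_lt_iff_ne.symm, h1, h2]
  rw [termLE, termKey_le_iff, hlt ha hb, heq, min_IP_term ha, min_IP_term hb, monKey_le_iff,
    WithTop.coe_lt_coe, WithTop.coe_inj, eq_comm (a := vertexIndex P v), toOrd_le, ← and_or_left]

/-- The term of `f` at `w` is the leading one. -/
def IsLead (hle : IsGMO le C) (f : PolytopalAlgebra K P) (w : Mon n) : Prop :=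
  f.coeff w ≠ 0 ∧ ∀ y, termKey hle P (f.coeff y) y ≤ termKey hle P (f.coeff w) w

variable (hle : IsGMO le C)

theorem exists_isLead {f : PolytopalAlgebra K P} (hf : f ≠ 0) : ∃ w, IsLead hle f w := by
  obtain ⟨u, hu⟩ := ne_zero_iff.mp hf
  have hpos := termNorm_pos (P := P) hu u
  -- Only finitely many terms are at least as large in norm as a given nonzero one, and the maximum
  -- may be sought among them.
  obtain ⟨w, hw, hmax⟩ := Set.exists_max_image _
    (fun y => termKey hle P (f.coeff y) y) (finite_le_termNorm f hpos)
    ⟨u, le_rfl (a := termNorm P (f.coeff u) u)⟩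
  refine ⟨w, fun h0 => ?_, fun y => ?_⟩
  · simp only [Set.mem_ofPred_eq, h0] at hw
    simp [termNorm] at hw hpos
    linarith
  · by_cases hy : termNorm P (f.coeff u) u ≤ termNorm P (f.coeff y) y
    · exact hmax y hy
    · exact (termKey_lt_of_termNorm_lt ((not_le.mp hy).trans_le hw)).le

variable {hle}

theorem IsLead.ne_zero {f : PolytopalAlgebra K P} {w : Mon n} (h : IsLead hle f w) : f ≠ 0 :=
  ne_zero_iff.mpr ⟨w, h.1⟩

theorem IsLead.lm_eq {f : PolytopalAlgebra K P} {w : Mon n} (h : IsLead hle f w) :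
    lm le f = w := by
  have hex : ∃ u, f.coeff u ≠ 0 ∧
      ∀ w, f.coeff w ≠ 0 → termLE P le (f.coeff w) w (f.coeff u) u :=
    ⟨w, h.1, fun y hy => (termLE_iff hle hy h.1).mpr (h.2 y)⟩
  rw [lm, dif_pos hex]
  obtain ⟨h1, h2⟩ := hex.choose_spec
  exact (eq_of_termKey_eq (le_antisymm (h.2 _) ((termLE_iff hle h.1 h1).mp (h2 w h.1)))).1

variable (hle) in
theorem isLead_lm {f : PolytopalAlgebra K P} (hf : f ≠ 0) : IsLead hle f (lm le f) := by
  obtain ⟨w, hw⟩ := exists_isLead hle hf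
  rwa [hw.lm_eq]

theorem isLead_iff {f : PolytopalAlgebra K P} (hf : f ≠ 0) {w : Mon n} :
    IsLead hle f w ↔ lm le f = w :=
  ⟨IsLead.lm_eq, fun h => h ▸ isLead_lm hle hf⟩

theorem IsLead.lt_of_ne {f : PolytopalAlgebra K P} {w y : Mon n} (h : IsLead hle f w)
    (hy : y ≠ w) : termKey hle P (f.coeff y) y < termKey hle P (f.coeff w) w :=
  (h.2 y).lt_of_ne fun he => hy (eq_of_termKey_eq he).1

theorem isLead_term {a : K} (ha : a ≠ 0) (u : Mon n) :
    IsLead hle (term a u : PolytopalAlgebra K P) u := by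
  refine ⟨by simpa [coeff_term] using ha, fun y => ?_⟩
  rcases eq_or_ne y u with rfl | hy
  · exact le_rfl
  · refine (termKey_lt_of_termNorm_lt ?_).le
    simp only [coeff_term, if_neg hy, if_true]
    exact (by simp [termNorm] : termNorm P (0 : K) y = 0).trans_lt (termNorm_pos ha u)

/-! ### Initial forms -/

theorem coeff_initialForm_ne_zero_iff {f : PolytopalAlgebra K P} {i : Fin P.numVert} {u : Mon n} :
    (initialForm i f).coeff u ≠ 0 ↔ f.coeff u ≠ 0 ∧
      ∀ w, ‖f.coeff w‖ * Real.exp (dot (P.vert i) w) ≤ ‖f.coeff u‖ * Real.exp (dot (P.vert i) u) := by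
  classical
  change (if val (f.coeff u) - (dot (P.vert i) u : EReal) = valr (P.vert i) f
      then f.coeff u else 0) ≠ 0 ↔ _
  rw [ne_eq, ite_eq_right_iff, Classical.not_imp, and_comm, and_congr_right_iff]
  intro hu
  simp only [← val_sub_le_iff hu]
  exact ⟨fun h w => h.le.trans (iInf_le _ w), fun h => le_antisymm (le_iInf h) (iInf_le _ u)⟩

theorem coeff_initialForm_eq {f : PolytopalAlgebra K P} {i : Fin P.numVert} {u : Mon n}
    (h : (initialForm i f).coeff u ≠ 0) : (initialForm i f).coeff u = f.coeff u := by
  classical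
  change (if val (f.coeff u) - (dot (P.vert i) u : EReal) = valr (P.vert i) f
      then f.coeff u else 0) ≠ 0 at h
  exact if_pos (by by_contra hc; exact h (if_neg hc))

theorem exists_coeff_initialForm_ne_zero {f : PolytopalAlgebra K P} (hf : f ≠ 0)
    (i : Fin P.numVert) : ∃ u, (initialForm i f).coeff u ≠ 0 := by
  simp only [coeff_initialForm_ne_zero_iff]
  obtain ⟨u, hu⟩ := ne_zero_iff.mp hf
  have hpos : 0 < ‖f.coeff u‖ * Real.exp (dot (P.vert i) u) :=
    mul_pos (norm_pos_iff.mpr hu) (Real.exp_pos _)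
  have hfin := ((convergesAt_iff _ _).mp (f.converges _ (P.vert_mem i))).eventually_lt_const hpos
  rw [eventually_cofinite] at hfin
  obtain ⟨w, hw, hmax⟩ := Set.exists_max_image _
    (fun y => ‖f.coeff y‖ * Real.exp (dot (P.vert i) y)) hfin ⟨u, by simp⟩
  simp only [not_lt, Set.mem_ofPred_eq] at hw hmax
  refine ⟨w, fun h0 => ?_, fun y => ?_⟩
  · rw [h0, norm_zero, zero_mul] at hw
    linarith
  · rcases le_total (‖f.coeff u‖ * Real.exp (dot (P.vert i) u))
      (‖f.coeff y‖ * Real.exp (dot (P.vert i) y)) with h | h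
    exacts [hmax y h, h.trans hw]

theorem lcCone_ne_zero (hle : IsGMO le C) {x : ι}
    (hC : AddSubgroup.closure (C x : Set (Mon n)) = ⊤) {f : PolytopalAlgebra K P} (hf : f ≠ 0)
    (i : Fin P.numVert) : lcCone le i (C x) f ≠ 0 :=
  coeff_lmConeL_ne_zero hle hC (exists_coeff_initialForm_ne_zero hf i)

theorem lcCone_eq (hle : IsGMO le C) {x : ι}
    (hC : AddSubgroup.closure (C x : Set (Mon n)) = ⊤) {f : PolytopalAlgebra K P} (hf : f ≠ 0)
    (i : Fin P.numVert) : lcCone le i (C x) f = f.coeff (lmCone le i (C x) f) :=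
  coeff_initialForm_eq (lcCone_ne_zero hle hC hf i)

end Leading

/-! ### Coefficients and multiplication by a term -/

section Ring

@[simp] theorem coeff_add (f g : PolytopalAlgebra K P) (u : Mon n) :
    (f + g).coeff u = f.coeff u + g.coeff u := rfl

variable [IsUltrametricDist K]

theorem coeff_term_mul (c : K) (t : Mon n) (f : PolytopalAlgebra K P) (u : Mon n) :
    (term c t * f).coeff u = c * f.coeff (u - t) := by
  rw [coeff_mul, tsum_eq_single t]
  · simp [coeff_term]
  · intro w hw
    simp [coeff_term, hw]

theorem coeff_term_mul_add (c : K) (t : Mon n) (f : PolytopalAlgebra K P) (u : Mon n) :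
    (term c t * f).coeff (u + t) = c * f.coeff u := by
  rw [coeff_term_mul, add_sub_cancel_right]

theorem term_mul_ne_zero {c : K} (hc : c ≠ 0) (t : Mon n) {f : PolytopalAlgebra K P}
    (hf : f ≠ 0) : term c t * f ≠ 0 := by
  obtain ⟨u, hu⟩ := ne_zero_iff.mp hf
  exact ne_zero_iff.mpr ⟨u + t, by rw [coeff_term_mul_add]; exact mul_ne_zero hc hu⟩

variable {le : Mon n → Mon n → Prop} {ι : Type*} {C : ι → AddSubmonoid (Mon n)} {hle : IsGMO le C}

theorem IsLead.add {f g : PolytopalAlgebra K P} {w : Mon n} (h : IsLead hle f w)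
    (hg : ∀ y, termKey hle P (g.coeff y) y < termKey hle P (f.coeff w) w) :
    IsLead hle (f + g) w := by
  have h1 : ‖g.coeff w‖ < ‖f.coeff w‖ := termKey_lt_same_iff.mp (hg w)
  have h2 : ‖(f + g).coeff w‖ = ‖f.coeff w‖ := by
    rw [coeff_add, IsUltrametricDist.norm_add_eq_max_of_norm_ne_norm h1.ne', max_eq_left h1.le]
  have h3 : termKey hle P ((f + g).coeff w) w = termKey hle P (f.coeff w) w :=
    le_antisymm (termKey_le_same_iff.mpr h2.le) (termKey_le_same_iff.mpr h2.ge)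
  refine ⟨fun h0 => h.1 (by simpa [h0] using h2.symm), fun y => ?_⟩
  rw [h3]
  exact (termKey_add_le _ _ _).trans (max_le (h.2 y) (hg y).le)

theorem IsLead.term_mul {f : PolytopalAlgebra K P} {t w : Mon n} {c : K} (hc : c ≠ 0)
    (h : IsLead hle (mono t * f) w) : IsLead hle (term c t * f) w := by
  obtain ⟨h1, h2⟩ := h
  simp only [IsLead, coeff_term_mul, one_mul] at h1 h2 ⊢
  refine ⟨mul_ne_zero hc h1, fun y => ?_⟩
  exact termKey_mul_le_mul hc (h2 y)

theorem lm_term_mul (hle : IsGMO le C) {f : PolytopalAlgebra K P} (hf : f ≠ 0) {t : Mon n} {c : K}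
    (hc : c ≠ 0) : lm le (term c t * f) = lm le (mono t * f) :=
  (IsLead.term_mul hc (isLead_lm hle (term_mul_ne_zero one_ne_zero t hf))).lm_eq

/-- The norm at `r_i` never exceeds the norm for `P`, and the two agree at the leading monomial `w`
of `X^t f`, whose index is `i`. So `w - t` belongs to the initial form at `r_i`, and every other
monomial of that form ties with it in norm and in index. Only the generalized monomial order then
decides. -/
theorem lm_eq_lmCone_add (hle : IsGMO le C) {x : ι}
    (hC : AddSubgroup.closure (C x : Set (Mon n)) = ⊤) {f : PolytopalAlgebra K P} (hf : f ≠ 0)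
    {i : Fin P.numVert} {t : Mon n} (ht : t ∈ coneSet le i (C x) f) :
    lm le (mono t * f) = lmCone le i (C x) f + t := by
  obtain ⟨hmem, hidx⟩ := ht
  rw [mem_Vlt_iff] at hidx
  have hl := isLead_lm hle (term_mul_ne_zero (P := P) (one_ne_zero (α := K)) t hf)
  set w := lm le (mono t * f) with hw
  obtain ⟨hne, hmax⟩ := hl
  simp only [coeff_term_mul, one_mul] at hne hmax
  have hwi : dot (P.vert i) w = gauge P w := hidx ▸ dot_vertexIndex P w
  have hnorm : ∀ y, ‖f.coeff y‖ * Real.exp (dot (P.vert i) y) * Real.exp (dot (P.vert i) t) ≤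
      termNorm P (f.coeff y) (y + t) := fun y => by
    rw [mul_assoc, ← Real.exp_add, ← dot_add, termNorm]
    gcongr
    exact dot_le_gauge P i _
  have hnormw : termNorm P (f.coeff (w - t)) w = ‖f.coeff (w - t)‖ *
      Real.exp (dot (P.vert i) (w - t)) * Real.exp (dot (P.vert i) t) := by
    rw [mul_assoc, ← Real.exp_add, ← dot_add, sub_add_cancel, termNorm, hwi]
  have hmax' : ∀ y, termKey hle P (f.coeff y) (y + t) ≤ termKey hle P (f.coeff (w - t)) w :=
    fun y => by simpa using hmax (y + t)
  have hin : (initialForm i f).coeff (w - t) ≠ 0 := by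
    refine coeff_initialForm_ne_zero_iff.mpr ⟨hne, fun y => ?_⟩
    refine le_of_mul_le_mul_right ?_ (Real.exp_pos (dot (P.vert i) t))
    rw [← hnormw]
    exact (hnorm y).trans (termNorm_le_of_termKey_le (hmax' y))
  have hlm : lmL le (AddMonoidAlgebra.single t 1 * initialForm i f) = w := by
    refine lmL_eq hle (by rwa [coeff_single_one_mul]) fun y hy => ?_
    rw [coeff_single_one_mul, coeff_initialForm_ne_zero_iff] at hy
    have h1 := hy.2 (w - t)
    have h2 := hnorm (y - t)
    have h3 := hmax' (y - t)
    rw [sub_add_cancel] at h2 h3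
    have h4 : termNorm P (f.coeff (w - t)) w ≤ ‖f.coeff (y - t)‖ *
        Real.exp (dot (P.vert i) (y - t)) * Real.exp (dot (P.vert i) t) := by
      rw [hnormw]
      gcongr
    have h5 : termNorm P (f.coeff (y - t)) y = termNorm P (f.coeff (w - t)) w :=
      le_antisymm (termNorm_le_of_termKey_le h3) (h4.trans h2)
    have hyi : dot (P.vert i) y = gauge P y := by
      have h6 := h5.le.trans h4
      rw [mul_assoc, ← Real.exp_add, ← dot_add, sub_add_cancel, termNorm] at h6
      refine le_antisymm (dot_le_gauge P i y) (Real.exp_le_exp.mp ?_)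
      exact le_of_mul_le_mul_left h6 (norm_pos_iff.mpr hy.1)
    rw [termKey_le_iff, h5, monKey_le_iff] at h3
    simp only [lt_irrefl, true_and, false_or] at h3
    -- The translated monomial `y` attains its gauge at `r_i`, so its index is at most `i`; a larger
    -- index is excluded.
    rcases h3 with h3 | h3
    · exact absurd (vertexIndex_le hyi) (by rw [← hidx]; exact not_le.mpr h3)
    · exact h3.2
  have hcone : t ∈ coneSetL le (C x) (initialForm i f) := by
    change lmL le _ ∈ C x
    rwa [hlm]
  rw [lmCone, lmConeL_eq hle hC (exists_coeff_initialForm_ne_zero hf i) hcone, hlm,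
    sub_add_cancel]

end Ring

end PolytopalAlgebra

end Polytopal

namespace Polytopal

/-! ### Gaps between the norms of terms -/

section Gap

theorem eventually_nhdsLT_one_ge {x : ℝ} (hx : x < 1) : ∀ᶠ ρ in 𝓝[<] (1 : ℝ), x ≤ ρ := by
  filter_upwards [Ioo_mem_nhdsLT hx] with ρ hρ using hρ.1.le

/-- Only finitely many values reach `κ / 2`, and each one below `κ` is separated from it. Stating
gaps for all `ρ` close to `1` from below allows finitely many of them to be combined. -/
theorem eventually_gap_of_tendsto {ι : Type*} {F : ι → ℝ} (hF : Tendsto F cofinite (𝓝 0)) {κ : ℝ}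
    (hκ : 0 < κ) : ∀ᶠ ρ in 𝓝[<] (1 : ℝ), ∀ x, F x < κ → F x ≤ ρ * κ := by
  have hfin := hF.eventually_lt_const (half_pos hκ)
  rw [eventually_cofinite] at hfin
  have h := (Filter.eventually_all_finite (l := 𝓝[<] (1 : ℝ))
    (p := fun x ρ => F x < κ → F x ≤ ρ * κ) hfin).mpr fun x _ => by
      by_cases hx : F x < κ
      · filter_upwards [eventually_nhdsLT_one_ge ((div_lt_one hκ).mpr hx)] with ρ hρ _
        exact (div_le_iff₀ hκ).mp hρ
      · exact .of_forall fun ρ h => absurd h hx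
  filter_upwards [h, eventually_nhdsLT_one_ge (show (1 / 2 : ℝ) < 1 by norm_num)] with ρ h1 h2 x hx
  by_cases hxκ : F x < κ / 2
  · nlinarith
  · exact h1 x hxκ hx

/-- By discreteness a strict inequality of norms in `K` costs at least one factor `‖π‖`, so every `ρ
≥ ‖π‖` is suitable. -/
theorem eventually_gap_norm {K : Type*} [NormedField K] (hK : IsDiscretelyValued K) :
    ∀ᶠ ρ in 𝓝[<] (1 : ℝ), ∀ a b : K, ‖a‖ < ‖b‖ → ‖a‖ ≤ ρ * ‖b‖ := by
  obtain ⟨π, h0, h1, hπ⟩ := hK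
  filter_upwards [eventually_nhdsLT_one_ge h1] with ρ hρ a b hab
  have hb : b ≠ 0 := by
    rintro rfl
    exact (norm_nonneg a).not_gt (by simpa using hab)
  rcases eq_or_ne a 0 with rfl | ha
  · rw [norm_zero]
    have := h0.trans_le hρ
    positivity
  obtain ⟨k, hk⟩ := hπ a ha
  obtain ⟨l, hl⟩ := hπ b hb
  rw [hk, hl] at hab
  have hlk : l < k := (zpow_lt_zpow_iff_right_of_lt_one₀ h0 h1).mp hab
  calc ‖a‖ = ‖π‖ ^ k := hk
    _ ≤ ‖π‖ ^ (l + 1) := zpow_le_zpow_right_of_le_one₀ h0 h1.le hlk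
    _ = ‖π‖ * ‖b‖ := by rw [zpow_add_one₀ h0.ne', hl, mul_comm]
    _ ≤ ρ * ‖b‖ := by gcongr

variable {n : ℕ}

/-- Rationality of the vertices enters here: all the scalar products lie in one lattice `(1/d)ℤ`. -/
theorem exists_common_denominator (P : RatPolytope n) :
    ∃ d : ℕ, 0 < d ∧ ∀ i, ∀ u : Mon n, ∃ z : ℤ, dot (P.vert i) u * d = z := by
  refine ⟨∏ i, ∏ k, (P.vert i k).den,
    Finset.prod_pos fun i _ => Finset.prod_pos fun k _ => (P.vert i k).den_pos, fun i u => ?_⟩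
  have h : ∀ k, ∃ z : ℤ,
      (P.vert i k : ℝ) * (u k : ℝ) * ((∏ i, ∏ k, (P.vert i k).den : ℕ) : ℝ) = z := by
    intro k
    obtain ⟨m, hm⟩ := (Finset.dvd_prod_of_mem (fun k => (P.vert i k).den) (Finset.mem_univ k)).trans
      (Finset.dvd_prod_of_mem (fun i => ∏ k, (P.vert i k).den) (Finset.mem_univ i))
    rw [hm]
    refine ⟨(P.vert i k).num * u k * m, ?_⟩
    have : (P.vert i k : ℝ) * ((P.vert i k).den : ℝ) = (P.vert i k).num := by
      exact_mod_cast Rat.mul_den_eq_num (P.vert i k)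
    push_cast
    rw [← this]
    ring
  choose z hz using h
  refine ⟨∑ k, z k, ?_⟩
  rw [dot, Finset.sum_mul]
  rw [Int.cast_sum]
  exact Finset.sum_congr rfl fun k _ => hz k

variable {K : Type*} [NormedField K] {P : RatPolytope n}

namespace PolytopalAlgebra

/-- The norms of the terms of the `X^t g`, for `t` in a vertex cone, do not accumulate at
multiples of the norm of `X^t` from below. -/
theorem eventually_gap (g : PolytopalAlgebra K P) (i : Fin P.numVert) {κ : ℝ} (hκ : 0 < κ) :
    ∀ᶠ ρ in 𝓝[<] (1 : ℝ), ∀ t, dot (P.vert i) t = gauge P t → ∀ y,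
      termNorm P (g.coeff y) (y + t) < κ * Real.exp (gauge P t) →
      termNorm P (g.coeff y) (y + t) ≤ ρ * (κ * Real.exp (gauge P t)) := by
  obtain ⟨d, hd, hz⟩ := exists_common_denominator P
  have hd' : (0 : ℝ) < d := by exact_mod_cast hd
  -- The loss incurred when `X^t` is measured at a vertex other than `r_i` is `N / d` with `N` a
  -- natural number. Pairing each coefficient of `g` with such an `N` gives a family tending to zero
  -- that no longer involves `t`; its gap below `κ` is therefore uniform in `t`.
  have hpow : Tendsto (fun N : ℕ => Real.exp (-(1 / d : ℝ)) ^ N) cofinite (𝓝 0) := by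
    rw [Nat.cofinite_eq_atTop]
    exact tendsto_pow_atTop_nhds_zero_of_lt_one (Real.exp_pos _).le
      (Real.exp_lt_one_iff.mpr (by simpa using hd'))
  have h : ∀ᶠ ρ in 𝓝[<] (1 : ℝ), ∀ p : Fin P.numVert, ∀ x : Mon n × ℕ, _ :=
    Filter.eventually_all.mpr fun p => eventually_gap_of_tendsto (tendsto_mul_cofinite_nhds_zero
      ((convergesAt_iff _ _).mp (g.converges _ (P.vert_mem p))) hpow) hκ
  filter_upwards [h] with ρ hρ t ht y hy
  -- The norm at `y + t` is read at a vertex `r_p` maximizing there, and compared with the gauge of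
  -- `t`, attained at `r_i`.
  obtain ⟨p, hp⟩ := exists_dot_eq_gauge P (y + t)
  obtain ⟨z₁, hz₁⟩ := hz i t
  obtain ⟨z₂, hz₂⟩ := hz p t
  have hle : z₂ ≤ z₁ := by
    have : (z₂ : ℝ) ≤ z₁ := by
      rw [← hz₁, ← hz₂, ht]
      exact mul_le_mul_of_nonneg_right (dot_le_gauge P p t) hd'.le
    exact_mod_cast this
  obtain ⟨N, hN⟩ := Int.le.dest hle
  have hN' : gauge P t - dot (P.vert p) t = N / d := by
    rw [eq_div_iff hd'.ne', sub_mul, ← ht, hz₁, hz₂, ← hN]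
    push_cast
    ring
  have key : termNorm P (g.coeff y) (y + t) =
      ‖g.coeff y‖ * Real.exp (dot (P.vert p) y) * Real.exp (-(1 / d : ℝ)) ^ N *
        Real.exp (gauge P t) := by
    rw [termNorm, ← hp, dot_add, ← Real.exp_nat_mul, mul_assoc, mul_assoc, ← Real.exp_add,
      ← Real.exp_add]
    congr 2
    have : (N : ℝ) * -(1 / d : ℝ) = -(N / d) := by ring
    rw [this, ← hN']
    ring
  rw [key] at hy ⊢
  rw [← mul_assoc]
  have he := Real.exp_pos (gauge P t)
  exact mul_le_mul_of_nonneg_right (hρ p (y, N) (lt_of_mul_lt_mul_right hy he.le)) he.le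

end PolytopalAlgebra

end Gap

/-! ### Counting gaps -/

/-- The number of factors `ρ` that fit between `ε` and `x`. -/
noncomputable def gapCount (ρ ε x : ℝ) : ℕ := ⌊Real.log (x / ε) / -Real.log ρ⌋₊

/-- Passing from `x` to `ρ * x` lowers the quotient of logarithms by exactly one, so its floor drops
by at least one. -/
theorem gapCount_lt {ρ ε x y : ℝ} (hρ0 : 0 < ρ) (hρ1 : ρ < 1) (hε : 0 < ε) (hy : ε ≤ y)
    (hyx : y ≤ ρ * x) : gapCount ρ ε y < gapCount ρ ε x := by
  have hlog : 0 < -Real.log ρ := neg_pos.mpr (Real.log_neg hρ0 hρ1)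
  have hy0 : 0 < y := hε.trans_le hy
  have hx0 : 0 < x := pos_of_mul_pos_right (hy0.trans_le hyx) hρ0.le
  have h1 : 0 ≤ Real.log (y / ε) / -Real.log ρ :=
    div_nonneg (Real.log_nonneg ((one_le_div hε).mpr hy)) hlog.le
  have h2 : Real.log (y / ε) / -Real.log ρ + 1 ≤ Real.log (x / ε) / -Real.log ρ := by
    rw [← div_add_same hlog.ne', Real.log_div hy0.ne' hε.ne', Real.log_div hx0.ne' hε.ne']
    gcongr
    have := Real.log_le_log hy0 hyx
    rw [Real.log_mul hρ0.ne' hx0.ne'] at this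
    linarith
  unfold gapCount
  rw [Nat.lt_iff_add_one_le, ← Nat.floor_add_one h1]
  exact Nat.floor_le_floor h2

namespace PolytopalAlgebra

variable {K : Type*} [NormedField K] [IsUltrametricDist K] [CompleteSpace K] {n : ℕ}
  {P : RatPolytope n}

@[simp] theorem coeff_sub (f g : PolytopalAlgebra K P) (u : Mon n) :
    (f - g).coeff u = f.coeff u - g.coeff u := (sub_eq_add_neg (f.coeff u) (g.coeff u)).symm

/-- The coefficients of a series, as an additive map. -/
def coeffHom : PolytopalAlgebra K P →+ (Mon n → K) where
  toFun := coeff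
  map_zero' := rfl
  map_add' _ _ := rfl

/-! ### Convergence of successive eliminations of leading terms -/

section Leading

variable {le : Mon n → Mon n → Prop} {ι : Type*} {C : ι → AddSubmonoid (Mon n)} {hle : IsGMO le C}

theorem IsLead.sub_lt {f g : PolytopalAlgebra K P} {w : Mon n} (hf : IsLead hle f w)
    (hg : IsLead hle g w) (h : g.coeff w = f.coeff w) (y : Mon n) :
    termKey hle P ((f - g).coeff y) y < termKey hle P (f.coeff w) w := by
  rw [coeff_sub]
  rcases eq_or_ne y w with rfl | hy
  · rw [h, sub_self, termKey_lt_same_iff, norm_zero, norm_pos_iff]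
    exact hf.1
  · refine (termKey_sub_le _ _ _).trans_lt (max_lt (hf.lt_of_ne hy) ?_)
    rw [← h]
    exact hg.lt_of_ne hy

/-- Successive elimination of leading terms, with a gap below each leading term, produces
arbitrarily small series. -/
theorem exists_termNorm_lt_of_reduction [WellFoundedLT (OrdMon hle)] {ρ : ℝ} (hρ0 : 0 < ρ)
    (hρ1 : ρ < 1) (hρ : ∀ a b : K, ‖a‖ < ‖b‖ → ‖a‖ ≤ ρ * ‖b‖) (f g : ℕ → PolytopalAlgebra K P)
    (hfg : ∀ N, f (N + 1) = f N - g N)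
    (hlead : ∀ N, f N ≠ 0 → IsLead hle (g N) (lm le (f N)) ∧ (g N).coeff (lm le (f N)) = lc le (f N))
    (hgap : ∀ N, f N ≠ 0 → ∀ y,
      termNorm P ((g N).coeff y) y < termNorm P (lc le (f N)) (lm le (f N)) →
      termNorm P ((g N).coeff y) y ≤ ρ * termNorm P (lc le (f N)) (lm le (f N)))
    {ε : ℝ} (hε : 0 < ε) : ∃ N, ∀ y, termNorm P ((f N).coeff y) y < ε := by
  by_contra! hcon
  have hf : ∀ N, f N ≠ 0 := fun N h0 => by
    obtain ⟨y, hy⟩ := hcon N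
    simp [h0, termNorm] at hy
    linarith
  have hl : ∀ N, IsLead hle (f N) (lm le (f N)) := fun N => isLead_lm hle (hf N)
  set x : ℕ → ℝ := fun N => termNorm P (lc le (f N)) (lm le (f N)) with hx
  have hle_x : ∀ N y, termNorm P ((f N).coeff y) y ≤ x N := fun N y =>
    termNorm_le_of_termKey_le ((hl N).2 y)
  have hεx : ∀ N, ε ≤ x N := fun N => by
    obtain ⟨y, hy⟩ := hcon N
    exact hy.trans (hle_x N y)
  have hanti : StrictAnti fun N => termKey hle P (lc le (f N)) (lm le (f N)) := by
    refine strictAnti_nat_of_succ_lt fun N => ?_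
    have := (hl N).sub_lt (hlead N (hf N)).1 (hlead N (hf N)).2 (lm le (f (N + 1)))
    rwa [← hfg] at this
  have hxanti : Antitone x := fun M N h => termNorm_le_of_termKey_le (hanti.antitone h)
  -- From a stage of minimal gap count on, the leading norm can never again fall by a factor `ρ`.
  obtain ⟨N₀, hN₀⟩ : ∃ N₀, ∀ N, gapCount ρ ε (x N₀) ≤ gapCount ρ ε (x N) :=
    ⟨_, fun N => Function.argmin_le (fun N => gapCount ρ ε (x N)) N⟩
  have hgt : ∀ N, ρ * x N₀ < x N := fun N => by
    by_contra! h
    exact (hN₀ N).not_gt (gapCount_lt hρ0 hρ1 hε (hεx N) h)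
  have hpos : 0 < ρ * x N₀ := mul_pos hρ0 (hε.trans_le (hεx N₀))
  set A : Set ℝ := (fun y => termNorm P ((f N₀).coeff y) y) ''
    {y | ρ * x N₀ ≤ termNorm P ((f N₀).coeff y) y} with hA
  have hAfin : A.Finite := (finite_le_termNorm _ hpos).image _
  -- No new norm appears above the threshold `ρ * x N₀`. The subtracted series contributes either
  -- the current leading norm, already in `A`, or something below the threshold by the gap. A
  -- cancellation between coefficients of equal norm keeps the norm or, by discreteness of `K`,
  -- lowers it by a factor `ρ`.
  have claim : ∀ M y, termNorm P ((f (N₀ + M)).coeff y) y ∈ A ∨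
      termNorm P ((f (N₀ + M)).coeff y) y ≤ ρ * x N₀ := by
    intro M
    induction M with
    | zero =>
      intro y
      rcases le_total (ρ * x N₀) (termNorm P ((f N₀).coeff y) y) with h | h
      exacts [.inl ⟨y, h, rfl⟩, .inr h]
    | succ M ih =>
      intro y
      set N := N₀ + M with hN
      have hxN : x N ≤ x N₀ := hxanti (Nat.le_add_right _ _)
      have hxA : x N ∈ A := (ih (lm le (f N))).resolve_right (hgt N).not_ge
      have hβ : termNorm P ((g N).coeff y) y ∈ A ∨ termNorm P ((g N).coeff y) y ≤ ρ * x N₀ := by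
        have h1 : termNorm P ((g N).coeff y) y ≤ x N := by
          have := (hlead N (hf N)).1.2 y
          rw [(hlead N (hf N)).2] at this
          exact termNorm_le_of_termKey_le this
        rcases h1.lt_or_eq with h1 | h1
        · exact .inr ((hgap N (hf N) y h1).trans (by gcongr))
        · exact .inl (h1 ▸ hxA)
      rw [← add_assoc, ← hN, hfg, coeff_sub]
      by_cases hne : ‖(f N).coeff y‖ = ‖(g N).coeff y‖
      · have hmax : ‖(f N).coeff y - (g N).coeff y‖ ≤ ‖(f N).coeff y‖ := by
          have := IsUltrametricDist.norm_add_le_max ((f N).coeff y) (-(g N).coeff y)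
          rwa [norm_neg, ← hne, max_self, ← sub_eq_add_neg] at this
        rcases hmax.lt_or_eq with h | h
        · right
          have h2 := mul_le_mul_of_nonneg_right (hρ _ _ h) (Real.exp_pos (gauge P y)).le
          rw [mul_assoc] at h2
          exact h2.trans (mul_le_mul_of_nonneg_left ((hle_x N y).trans hxN) hρ0.le)
        · rw [termNorm, h]
          exact ih y
      · have h := IsUltrametricDist.norm_add_eq_max_of_norm_ne_norm
          (x := (f N).coeff y) (y := -(g N).coeff y) (by rwa [norm_neg])
        rw [← sub_eq_add_neg, norm_neg] at h
        rw [termNorm, h]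
        rcases max_choice ‖(f N).coeff y‖ ‖(g N).coeff y‖ with h | h
        · rw [h]; exact ih y
        · rw [h]; exact hβ
  have hxA : ∀ M, x (N₀ + M) ∈ A := fun M => (claim M _).resolve_right (hgt _).not_ge
  have : Finite A := hAfin
  have : WellFoundedLT A := Finite.to_wellFoundedLT
  -- The leading norms thus lie in the finite set `A`, and the leading keys would decrease forever
  -- in a well-order.
  refine not_strictAnti_of_wellFoundedLT
    (fun M => (toLex (⟨x (N₀ + M), hxA M⟩, monKey hle P (lm le (f (N₀ + M)))) :
      A ×ₗ ((Fin P.numVert)ᵒᵈ ×ₗ OrdMon hle))) fun M N hMN => ?_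
  have := termKey_lt_iff.mp (hanti (Nat.add_lt_add_left hMN N₀))
  rw [Prod.Lex.toLex_lt_toLex]
  simpa [Subtype.ext_iff] using this

end Leading

end PolytopalAlgebra

end Polytopal

namespace Polytopal

namespace PolytopalAlgebra

variable {K : Type*} [NormedField K] {n : ℕ} {P : RatPolytope n}
  {D : Fin P.numVert → Type*} {T : ∀ i, D i → AddSubmonoid (Mon n)}
  {le : Mon n → Mon n → Prop}

/-! ### Leading monomials in the cones of conic decompositions -/

section Cones

theorem dot_eq_gauge_of_mem (hT : ∀ i, IsConicDecomposition (V K P i) (T i)) {i : Fin P.numVert}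
    {j : D i} {t : Mon n} (ht : t ∈ T i j) : dot (P.vert i) t = gauge P t := by
  rw [← mem_V_iff (K := K), ← (hT i).iUnion_eq]
  exact Set.mem_iUnion.mpr ⟨j, ht⟩

theorem exists_mem_cone (hT : ∀ i, IsConicDecomposition (V K P i) (T i)) (u : Mon n) :
    ∃ j, u ∈ T (vertexIndex P u) j := by
  have h : u ∈ V K P (vertexIndex P u) := mem_V_iff.mpr (dot_vertexIndex P u)
  rw [← (hT _).iUnion_eq] at h
  exact Set.mem_iUnion.mp h

theorem wellFoundedLT_ordMon_of_isConicDecomposition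
    (hT : ∀ i, IsConicDecomposition (V K P i) (T i))
    (hle : IsGMO le fun x : (Σ i, D i) => T x.1 x.2) : WellFoundedLT (OrdMon hle) := by
  have : ∀ i, Finite (D i) := fun i => (hT i).finite
  refine wellFoundedLT_ordMon hle (fun x => (hT x.1).fg x.2) fun u => ?_
  obtain ⟨j, hj⟩ := exists_mem_cone hT u
  exact ⟨⟨_, j⟩, hj⟩

variable [IsUltrametricDist K]

theorem mem_coneSet_iff {i : Fin P.numVert} {C : AddSubmonoid (Mon n)}
    {h : PolytopalAlgebra K P} {t : Mon n} : t ∈ coneSet le i C h ↔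
      lm le (mono t * h) ∈ C ∧ vertexIndex P (lm le (mono t * h)) = i := by
  rw [← mem_Vlt_iff (K := K)]
  rfl

variable (hT : ∀ i, IsConicDecomposition (V K P i) (T i))
  (hle : IsGMO le fun x : (Σ i, D i) => T x.1 x.2)
include hT hle

omit [IsUltrametricDist K] in
theorem lcCone_eq_coeff {h : PolytopalAlgebra K P} (h0 : h ≠ 0) (i : Fin P.numVert) (j : D i) :
    lcCone le i (T i j) h = h.coeff (lmCone le i (T i j) h) ∧ lcCone le i (T i j) h ≠ 0 :=
  ⟨lcCone_eq hle (x := ⟨i, j⟩) ((hT i).generates j) h0 i,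
    lcCone_ne_zero hle (x := ⟨i, j⟩) ((hT i).generates j) h0 i⟩

theorem lm_mono_mul_eq {h : PolytopalAlgebra K P} (h0 : h ≠ 0) {i : Fin P.numVert} {j : D i}
    {t : Mon n} (ht : t ∈ coneSet le i (T i j) h) :
    lm le (mono t * h) = lmCone le i (T i j) h + t :=
  lm_eq_lmCone_add hle (x := ⟨i, j⟩) ((hT i).generates j) h0 ht

theorem isLead_of_mem_coneSet {h : PolytopalAlgebra K P} (h0 : h ≠ 0) {i : Fin P.numVert} {j : D i}
    {t : Mon n} (ht : t ∈ coneSet le i (T i j) h) {c : K} (hc : c ≠ 0) :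
    IsLead hle (term c t * h) (lmCone le i (T i j) h + t) ∧
      (term c t * h).coeff (lmCone le i (T i j) h + t) = c * lcCone le i (T i j) h := by
  rw [isLead_iff (term_mul_ne_zero hc t h0), lm_term_mul hle h0 hc, coeff_term_mul_add,
    (lcCone_eq_coeff hT hle h0 i j).1]
  exact ⟨lm_mono_mul_eq hT hle h0 ht, rfl⟩

omit hT hle in
theorem mem_coneSet_of_isLead {hle : IsGMO le fun x : (Σ i, D i) => T x.1 x.2}
    {h : PolytopalAlgebra K P} {i : Fin P.numVert} {j : D i}
    {c : K} {t w : Mon n} (hl : IsLead hle (term c t * h) w) (hw : w ∈ T i j)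
    (hi : vertexIndex P w = i) : t ∈ coneSet le i (T i j) h := by
  have hc : c ≠ 0 := by
    rintro rfl
    exact hl.1 (by rw [coeff_term_mul, zero_mul])
  have h0 : h ≠ 0 := by
    rintro rfl
    exact hl.1 (by rw [coeff_term_mul, coeff_zero, mul_zero])
  have := hl.lm_eq
  rw [lm_term_mul hle h0 hc] at this
  rw [mem_coneSet_iff, this]
  exact ⟨hw, hi⟩

theorem eq_of_isLead {h : PolytopalAlgebra K P} {i : Fin P.numVert} {j : D i}
    {c : K} {t w : Mon n} (hl : IsLead hle (term c t * h) w) (hw : w ∈ T i j)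
    (hi : vertexIndex P w = i) : w = lmCone le i (T i j) h + t := by
  have ht := mem_coneSet_of_isLead hl hw hi
  have h0 : h ≠ 0 := by
    rintro rfl
    exact hl.1 (by rw [coeff_term_mul, coeff_zero, mul_zero])
  have hc : c ≠ 0 := by
    rintro rfl
    exact hl.1 (by rw [coeff_term_mul, zero_mul])
  rw [← hl.lm_eq, (isLead_of_mem_coneSet hT hle h0 ht hc).1.lm_eq]

/-- The norms of the terms of the multiples of `h` by terms do not accumulate at the norm of the
leading term from below. -/
theorem eventually_gap_isLead {h : PolytopalAlgebra K P} (h0 : h ≠ 0) :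
    ∀ᶠ ρ in 𝓝[<] (1 : ℝ), ∀ c u w, IsLead hle (term c u * h) w → ∀ y,
      termNorm P ((term c u * h).coeff y) y < termNorm P ((term c u * h).coeff w) w →
      termNorm P ((term c u * h).coeff y) y ≤ ρ * termNorm P ((term c u * h).coeff w) w := by
  have : ∀ i, Finite (D i) := fun i => (hT i).finite
  -- Each divisor is translated so that its leading monomial for the cone sits at exponent zero. The
  -- multiple with leading monomial `w` is then a scalar times the translate by `w` itself, which
  -- attains its gauge at its index vertex.
  have hg : ∀ᶠ ρ in 𝓝[<] (1 : ℝ), ∀ x : Σ i, D i, _ := Filter.eventually_all.mpr fun x =>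
    eventually_gap (mono (-lmCone le x.1 (T x.1 x.2) h) * h) x.1
      (norm_pos_iff.mpr (lcCone_eq_coeff hT hle h0 x.1 x.2).2)
  filter_upwards [hg] with ρ hρ c u w hl y hy
  obtain ⟨j, hj⟩ := exists_mem_cone hT w
  have hw := eq_of_isLead hT hle hl hj rfl
  have hc : c ≠ 0 := by
    rintro rfl
    exact hl.1 (by rw [coeff_term_mul, zero_mul])
  have h1 := hρ ⟨_, j⟩ w (dot_vertexIndex P w) (y - w)
  simp only [coeff_term_mul, one_mul, sub_add_cancel] at h1 hy ⊢
  have e1 : y - w - -lmCone le (vertexIndex P w) (T (vertexIndex P w) j) h = y - u := by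
    nth_rewrite 1 [hw]
    abel
  have e2 : w - u = lmCone le (vertexIndex P w) (T (vertexIndex P w) j) h := by
    nth_rewrite 1 [hw]
    abel
  rw [e1] at h1
  rw [e2, ← (lcCone_eq_coeff hT hle h0 _ j).1, termNorm_mul, termNorm_mul] at hy ⊢
  rw [mul_left_comm]
  exact mul_le_mul_of_nonneg_left (h1 (lt_of_mul_lt_mul_left hy (norm_nonneg c))) (norm_nonneg c)

variable [CompleteSpace K]

/-- Both halves of the S-pair have the leading term `lc f · lc g · X^v`, which cancels. -/
theorem termKey_sPair_lt {f g : PolytopalAlgebra K P} (hf : f ≠ 0) (hg : g ≠ 0)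
    {i : Fin P.numVert} {j : D i} {v : Mon n} (hvf : v ∈ lmConeSet le i (T i j) f)
    (hvg : v ∈ lmConeSet le i (T i j) g) (y : Mon n) :
    termKey hle P ((sPair le i (T i j) f g v).coeff y) y <
      termKey hle P (lcCone le i (T i j) g * lcCone le i (T i j) f) v := by
  obtain ⟨s, hs, rfl⟩ := hvf
  obtain ⟨t, ht, hst⟩ := hvg
  have h1 := isLead_of_mem_coneSet hT hle hf hs (lcCone_eq_coeff hT hle hg i j).2
  have h2 := isLead_of_mem_coneSet hT hle hg ht (lcCone_eq_coeff hT hle hf i j).2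
  rw [← hst] at h2
  have e1 : lmCone le i (T i j) f + s - lmCone le i (T i j) g = t := by rw [hst]; abel
  rw [sPair, add_sub_cancel_left, e1, ← h1.2]
  exact h1.1.sub_lt h2.1 (by rw [h1.2, h2.2, mul_comm]) y

end Cones

/-! ### Division -/

section Division

variable [IsUltrametricDist K] [CompleteSpace K] {m : ℕ} {h : Fin m → PolytopalAlgebra K P}

theorem exists_divStep (le : Mon n → Mon n → Prop) (T : ∀ i, D i → AddSubmonoid (Mon n))
    (h : Fin m → PolytopalAlgebra K P) (s : DivState K P m) : ∃ s', DivStep le T h s s' := by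
  obtain ⟨f, q, r⟩ := s
  by_cases hf : f = 0
  · subst hf
    exact ⟨_, .halt q r⟩
  by_cases hlm : ∃ (i : Fin P.numVert) (j : D i) (k : Fin m),
      lm le (mono (factor le i (T i j) f (h k)) * h k) = lm le f
  · obtain ⟨i, j, k, hk⟩ := hlm
    exact ⟨_, .reduce f q r _ i j k hf hk rfl⟩
  · push Not at hlm
    exact ⟨_, .shift f q r hf hlm⟩

theorem exists_isDivRun (le : Mon n → Mon n → Prop) (T : ∀ i, D i → AddSubmonoid (Mon n))
    (h : Fin m → PolytopalAlgebra K P) (f : PolytopalAlgebra K P) :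
    ∃ run, IsDivRun le T h f run := by
  choose next hnext using exists_divStep le T h
  exact ⟨fun N => next^[N] ⟨f, 0, 0⟩, rfl, fun N => by
    rw [Function.iterate_succ_apply']
    exact hnext _⟩

/-- The dividend stays in `J` after each reduction, so it remains reducible as long as it is
nonzero, and no shift can occur. -/
theorem IsDivRun.rem_eq_zero {J : Ideal (PolytopalAlgebra K P)} (hJ : ∀ k, h k ∈ J)
    (hred : ∀ f ∈ J, f ≠ 0 → ∃ (i : Fin P.numVert) (j : D i) (k : Fin m),
      lm le (mono (factor le i (T i j) f (h k)) * h k) = lm le f)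
    {f : PolytopalAlgebra K P} (hf : f ∈ J) {run : ℕ → DivState K P m}
    (hrun : IsDivRun le T h f run) (N : ℕ) : (run N).cur ∈ J ∧ (run N).rem = 0 := by
  induction N with
  | zero =>
    rw [hrun.start]
    exact ⟨hf, rfl⟩
  | succ N ih =>
    have hstep := hrun.step N
    generalize run N = s at ih hstep
    generalize run (N + 1) = s' at hstep
    cases hstep with
    | halt => exact ih
    | reduce f q s t i j k hf hlm ht => exact ⟨J.sub_mem ih.1 (J.mul_mem_left _ (hJ k)), ih.2⟩
    | shift f q s hf hlm =>
      obtain ⟨i, j, k, hk⟩ := hred f ih.1 hf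
      exact absurd hk (hlm i j k)

theorem hasRemainder_zero_of_rem_eq_zero {run : ℕ → DivState K P m}
    (hrun : ∀ N, (run N).rem = 0) : HasRemainder run 0 := by
  have h0 : valP (0 : PolytopalAlgebra K P) = ⊤ := by
    simp [valP, valr, val_zero]
  simp only [HasRemainder, hrun, sub_zero, h0]
  exact tendsto_const_nhds

variable (hT : ∀ i, IsConicDecomposition (V K P i) (T i))
  (hle : IsGMO le fun x : (Σ i, D i) => T x.1 x.2)

include hT in
/-- One step of the division algorithm, as the subtraction of a series with the same leading
term. -/
theorem DivStep.cases_isLead (h0 : ∀ k, h k ≠ 0) {s s' : DivState K P m}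
    (hs : DivStep le T h s s') :
    (s.cur = 0 ∧ s' = s) ∨
    (s.cur ≠ 0 ∧ ∃ k c z, IsLead hle (term c z * h k) (lm le s.cur) ∧
      (term c z * h k).coeff (lm le s.cur) = lc le s.cur ∧ s'.cur = s.cur - term c z * h k ∧
      s'.rem = s.rem) ∨
    (s.cur ≠ 0 ∧ s'.cur = s.cur - lt le s.cur ∧ s'.rem = s.rem + lt le s.cur) := by
  cases hs with
  | halt q s => exact .inl ⟨rfl, rfl⟩
  | reduce f q s t i j k hf hlm ht =>
    refine .inr (.inl ⟨hf, k, _, _, ?_, ?_, congrArg (f - · * h k) ht, rfl⟩)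
    · rw [isLead_iff, lm_term_mul hle (h0 k)]
      · exact hlm
      · exact div_ne_zero (isLead_lm hle hf).1 (lcCone_eq_coeff hT hle (h0 k) i j).2
      · exact term_mul_ne_zero
          (div_ne_zero (isLead_lm hle hf).1 (lcCone_eq_coeff hT hle (h0 k) i j).2) _ (h0 k)
    · obtain ⟨h1, h2⟩ := lcCone_eq_coeff hT hle (h0 k) i j
      rw [coeff_term_mul, factor, sub_sub_cancel, ← h1, div_mul_cancel₀ _ h2]
  | shift f q s hf hlm => exact .inr (.inr ⟨hf, rfl, rfl⟩)

include hT in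
theorem DivStep.termKey_lt (h0 : ∀ k, h k ≠ 0) {s s' : DivState K P m}
    (hs : DivStep le T h s s') (hcur : s.cur ≠ 0) (y : Mon n) :
    termKey hle P (s'.cur.coeff y) y < termKey hle P (lc le s.cur) (lm le s.cur) := by
  have hl := isLead_lm hle hcur
  rcases hs.cases_isLead hT hle h0 with h | ⟨-, k, c, z, h1, h2, h3, -⟩ | ⟨-, h3, -⟩
  · exact absurd h.1 hcur
  · rw [h3]
    exact hl.sub_lt h1 h2 y
  · rw [h3]
    refine hl.sub_lt (isLead_term hl.1 _) ?_ y
    rw [coeff_term, if_pos rfl]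

include hT in
theorem DivStep.termKey_lt_of_lt (h0 : ∀ k, h k ≠ 0) {s s' : DivState K P m}
    (hs : DivStep le T h s s') {b : K} {w : Mon n}
    (hlt : ∀ y, termKey hle P (s.cur.coeff y) y < termKey hle P b w) (y : Mon n) :
    termKey hle P (s'.cur.coeff y) y < termKey hle P b w := by
  by_cases hcur : s.cur = 0
  · rcases hs.cases_isLead hT hle h0 with h | h | h
    · rw [h.2]
      exact hlt y
    · exact absurd hcur h.1
    · exact absurd hcur h.1
  · exact (hs.termKey_lt hT hle h0 hcur y).trans (hlt _)

include hT hle in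
/-- If the remainder is zero, then no term is ever moved to it. -/
theorem IsDivRun.rem_eq_zero_of_hasRemainder_zero (h0 : ∀ k, h k ≠ 0)
    {f : PolytopalAlgebra K P} {run : ℕ → DivState K P m} (hrun : IsDivRun le T h f run)
    (hrem : HasRemainder run 0) (N : ℕ) : (run N).rem = 0 := by
  by_contra hN
  -- At the first shift a nonzero term `a X^w` enters the remainder. All later leading terms are
  -- strictly smaller, so they cannot change the norm of the coefficient at `w`.
  obtain ⟨N₀, h1, h2⟩ : ∃ N, (run N).rem = 0 ∧ (run (N + 1)).rem ≠ 0 := by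
    by_contra! hcon
    refine hN ?_
    induction N with
    | zero => rw [hrun.start]
    | succ N ih => exact hcon N (by_contra fun hn => hn (ih hn))
  rcases (hrun.step N₀).cases_isLead hT hle h0 with h | h | h
  · exact h2 (by rw [h.2, h1])
  · obtain ⟨-, k, c, z, -, -, -, h⟩ := h
    exact h2 (by rw [h, h1])
  obtain ⟨hcur, -, hrem₁⟩ := h
  set a := lc le (run N₀).cur with ha
  set w := lm le (run N₀).cur with hw
  have ha0 : a ≠ 0 := (isLead_lm hle hcur).1
  have inv : ∀ M, (∀ y, termKey hle P ((run (N₀ + 1 + M)).cur.coeff y) y < termKey hle P a w) ∧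
      ‖(run (N₀ + 1 + M)).rem.coeff w - a‖ < ‖a‖ := by
    intro M
    induction M with
    | zero =>
      refine ⟨(hrun.step N₀).termKey_lt hT hle h0 hcur, ?_⟩
      rw [add_zero, hrem₁, h1, zero_add, lt, coeff_term, if_pos rfl, sub_self, norm_zero]
      exact norm_pos_iff.mpr ha0
    | succ M ih =>
      have hs := hrun.step (N₀ + 1 + M)
      refine ⟨hs.termKey_lt_of_lt hT hle h0 ih.1, ?_⟩
      rw [← add_assoc]
      rcases hs.cases_isLead hT hle h0 with h | ⟨-, k, c, z, -, -, -, h⟩ | ⟨-, -, h⟩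
      · rw [h.2]
        exact ih.2
      · rw [h]
        exact ih.2
      · rw [h, coeff_add, add_sub_right_comm]
        refine (IsUltrametricDist.norm_add_le_max _ _).trans_lt (max_lt ih.2 ?_)
        rw [lt, coeff_term]
        split_ifs with he
        · have := ih.1 w
          rwa [termKey_lt_same_iff, he] at this
        · rw [norm_zero]
          exact norm_pos_iff.mpr ha0
  -- One vertex and the single monomial `w` already bound `val_P` of the remainder, contradicting
  -- convergence to zero.
  have hbound : ∀ M, valP ((run (N₀ + 1 + M)).rem - 0) ≤
      ((-Real.log ‖a‖ - dot (P.vert ⟨0, P.numVert_pos⟩) w : ℝ) : EReal) := by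
    intro M
    refine (iInf₂_le _ (P.vert_mem ⟨0, P.numVert_pos⟩)).trans ((iInf_le _ w).trans ?_)
    have hnorm : ‖(run (N₀ + 1 + M)).rem.coeff w‖ = ‖a‖ := by
      have h3 := IsUltrametricDist.norm_add_eq_max_of_norm_ne_norm (inv M).2.ne
      rwa [sub_add_cancel, max_eq_right (inv M).2.le] at h3
    have hne : (run (N₀ + 1 + M)).rem.coeff w ≠ 0 := by
      rw [← norm_ne_zero_iff, hnorm]
      exact norm_ne_zero_iff.mpr ha0
    rw [sub_zero, val_of_ne_zero hne, hnorm, EReal.coe_sub]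
  have hev := (EReal.tendsto_nhds_top_iff_real.mp hrem)
    (-Real.log ‖a‖ - dot (P.vert ⟨0, P.numVert_pos⟩) w)
  obtain ⟨N₁, hN₁⟩ := eventually_atTop.mp hev
  exact (hN₁ (N₀ + 1 + N₁) (by omega)).not_ge (hbound N₁)

/-- The series `c X^u h_k` encoded by a triple `(c, k, u)`. -/
noncomputable def termEval (h : Fin m → PolytopalAlgebra K P) (e : K × Fin m × Mon n) :
    PolytopalAlgebra K P :=
  term e.1 e.2.2 * h e.2.1

include hT in
/-- A division with remainder zero expresses the dividend as a finite combination of the divisors,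
up to an arbitrarily small error. -/
theorem IsDivRun.exists_expansion (hK : IsDiscretelyValued K) (h0 : ∀ k, h k ≠ 0)
    {f : PolytopalAlgebra K P} {run : ℕ → DivState K P m} (hrun : IsDivRun le T h f run)
    (hrem : HasRemainder run 0) {b : K} {w : Mon n}
    (hf : ∀ y, termKey hle P (f.coeff y) y < termKey hle P b w) {ε : ℝ} (hε : 0 < ε) :
    ∃ E : Multiset (K × Fin m × Mon n),
      (∀ y, termNorm P ((f - (E.map (termEval h)).sum).coeff y) y < ε) ∧
      ∀ e ∈ E, ∃ x, IsLead hle (termEval h e) x ∧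
        termKey hle P ((termEval h e).coeff x) x < termKey hle P b w := by
  have hzero := hrun.rem_eq_zero_of_hasRemainder_zero hT hle h0 hrem
  have hlt : ∀ N y, termKey hle P ((run N).cur.coeff y) y < termKey hle P b w := by
    intro N
    induction N with
    | zero => rw [hrun.start]; exact hf
    | succ N ih => exact (hrun.step N).termKey_lt_of_lt hT hle h0 ih
  have hstep : ∀ N, (run N).cur ≠ 0 → ∃ k c z, IsLead hle (term c z * h k) (lm le (run N).cur) ∧
      (term c z * h k).coeff (lm le (run N).cur) = lc le (run N).cur ∧
      (run (N + 1)).cur = (run N).cur - term c z * h k := by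
    intro N hN
    rcases (hrun.step N).cases_isLead hT hle h0 with h | ⟨-, k, c, z, h1, h2, h3, -⟩ | ⟨-, -, h⟩
    · exact absurd h.1 hN
    · exact ⟨k, c, z, h1, h2, h3⟩
    -- A shift would add a nonzero term to a remainder that is always zero.
    · rw [hzero, hzero, zero_add] at h
      exact absurd h.symm (isLead_term (hle := hle) (isLead_lm hle hN).1 _).ne_zero
  have hhalt : ∀ N, (run N).cur = 0 → (run (N + 1)).cur = 0 := by
    intro N hN
    rcases (hrun.step N).cases_isLead hT hle h0 with h | h | h
    · rw [h.2, hN]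
    · exact absurd hN h.1
    · exact absurd hN h.1
  have hexp : ∀ N, ∃ E : Multiset (K × Fin m × Mon n),
      f - (E.map (termEval h)).sum = (run N).cur ∧
      ∀ e ∈ E, ∃ x, IsLead hle (termEval h e) x ∧
        termKey hle P ((termEval h e).coeff x) x < termKey hle P b w := by
    intro N
    induction N with
    | zero => exact ⟨0, by simp [hrun.start], by simp⟩
    | succ N ih =>
      obtain ⟨E, hE1, hE2⟩ := ih
      by_cases hN : (run N).cur = 0
      · exact ⟨E, by rw [hE1, hN, hhalt N hN], hE2⟩
      obtain ⟨k, c, z, h1, h2, h3⟩ := hstep N hN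
      refine ⟨(c, k, z) ::ₘ E, ?_, ?_⟩
      · rw [Multiset.map_cons, Multiset.sum_cons, h3, ← hE1, termEval]
        abel
      · intro e he
        rcases Multiset.mem_cons.mp he with rfl | he
        · refine ⟨_, h1, ?_⟩
          rw [termEval, h2]
          exact hlt N _
        · exact hE2 e he
  -- The dividend after `N` steps is exactly the error of the expansion truncated there; it remains
  -- to make it small.
  suffices hs : ∃ N, ∀ y, termNorm P ((run N).cur.coeff y) y < ε by
    obtain ⟨N, hN⟩ := hs
    obtain ⟨E, hE1, hE2⟩ := hexp N
    exact ⟨E, by rwa [hE1], hE2⟩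
  -- A single `ρ` is taken for `K` and for all the divisors.
  have hgap : ∀ᶠ ρ in 𝓝[<] (1 : ℝ), ∀ k, _ :=
    Filter.eventually_all.mpr fun k => eventually_gap_isLead hT hle (h0 k)
  obtain ⟨ρ, ⟨hρ1, hρ2⟩, hρ3, hρ4⟩ :=
    ((eventually_mem_set.mpr (Ioo_mem_nhdsLT (zero_lt_one (α := ℝ)))).and
      ((eventually_gap_norm hK).and hgap)).exists
  have := wellFoundedLT_ordMon_of_isConicDecomposition hT hle
  refine exists_termNorm_lt_of_reduction (hle := hle) hρ1 hρ2 hρ3 (fun N => (run N).cur)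
    (fun N => (run N).cur - (run (N + 1)).cur) (fun N => (sub_sub_cancel _ _).symm)
    (fun N hN => ?_) (fun N hN => ?_) hε
  · obtain ⟨k, c, z, h1, h2, h3⟩ := hstep N hN
    rw [h3, sub_sub_cancel]
    exact ⟨h1, h2⟩
  · obtain ⟨k, c, z, h1, h2, h3⟩ := hstep N hN
    rw [h3, sub_sub_cancel, ← h2]
    exact hρ4 k c z _ h1

end Division

end PolytopalAlgebra

end Polytopal

namespace Polytopal

namespace PolytopalAlgebra

variable {K : Type*} [NormedField K] {n : ℕ} {P : RatPolytope n}

/-! ### Series with small terms -/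

section Small

variable {le : Mon n → Mon n → Prop} {ι : Type*} {C : ι → AddSubmonoid (Mon n)}

/-- The norm of the leading term. -/
noncomputable def leadNorm (le : Mon n → Mon n → Prop) (f : PolytopalAlgebra K P) : ℝ :=
  termNorm P (lc le f) (lm le f)

/-- The key of the leading term. -/
noncomputable def leadKey (hle : IsGMO le C) (f : PolytopalAlgebra K P) :
    ℝ ×ₗ ((Fin P.numVert)ᵒᵈ ×ₗ OrdMon hle) :=
  termKey hle P (lc le f) (lm le f)

theorem IsLead.leadNorm_eq {hle : IsGMO le C} {f : PolytopalAlgebra K P} {w : Mon n}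
    (h : IsLead hle f w) : leadNorm le f = termNorm P (f.coeff w) w := by
  rw [leadNorm, lc, h.lm_eq]

theorem IsLead.leadKey_eq {hle : IsGMO le C} {f : PolytopalAlgebra K P} {w : Mon n}
    (h : IsLead hle f w) : leadKey hle f = termKey hle P (f.coeff w) w := by
  rw [leadKey, lc, h.lm_eq]

theorem termNorm_le_leadNorm (hle : IsGMO le C) {f : PolytopalAlgebra K P} (hf : f ≠ 0)
    (y : Mon n) : termNorm P (f.coeff y) y ≤ leadNorm le f :=
  termNorm_le_of_termKey_le ((isLead_lm hle hf).2 y)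

theorem leadNorm_pos (hle : IsGMO le C) {f : PolytopalAlgebra K P} (hf : f ≠ 0) :
    0 < leadNorm le f :=
  termNorm_pos (isLead_lm hle hf).1 _

variable [IsUltrametricDist K] [CompleteSpace K]

omit [CompleteSpace K] in
-- Submultiplicativity of the norm for `P`, from subadditivity of the gauge and the ultrametric
-- inequality for sums.
theorem termNorm_mul_le {g h : PolytopalAlgebra K P} {A B : ℝ} (hA : 0 ≤ A)
    (hg : ∀ w, termNorm P (g.coeff w) w ≤ A) (hh : ∀ w, termNorm P (h.coeff w) w ≤ B)
    (y : Mon n) : termNorm P ((g * h).coeff y) y ≤ A * B := by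
  have hB : 0 ≤ B := (termNorm_nonneg _ _).trans (hh 0)
  rw [termNorm, ← le_div_iff₀ (Real.exp_pos _), coeff_mul]
  refine IsUltrametricDist.norm_tsum_le_of_forall_le_of_nonneg (by positivity) fun w => ?_
  rw [le_div_iff₀ (Real.exp_pos _), norm_mul]
  calc ‖g.coeff w‖ * ‖h.coeff (y - w)‖ * Real.exp (gauge P y)
      ≤ ‖g.coeff w‖ * ‖h.coeff (y - w)‖ * Real.exp (gauge P w + gauge P (y - w)) := by
        gcongr
        simpa using gauge_add_le P w (y - w)
    _ = termNorm P (g.coeff w) w * termNorm P (h.coeff (y - w)) (y - w) := by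
        rw [Real.exp_add, termNorm, termNorm]
        ring
    _ ≤ A * B := mul_le_mul (hg w) (hh _) (termNorm_nonneg _ _) hA

variable (K P) in
/-- The series all of whose terms have norm less than `ε`. -/
def smallSubgroup {ε : ℝ} (hε : 0 < ε) : AddSubgroup (PolytopalAlgebra K P) where
  carrier := {f | ∀ y, termNorm P (f.coeff y) y < ε}
  zero_mem' y := by simpa [termNorm] using hε
  add_mem' {f g} hf hg y := by
    rcases le_total ‖f.coeff y‖ ‖g.coeff y‖ with h | h
    · refine (termNorm_le_iff.mpr ?_).trans_lt (hg y)
      simpa [h] using IsUltrametricDist.norm_add_le_max (f.coeff y) (g.coeff y)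
    · refine (termNorm_le_iff.mpr ?_).trans_lt (hf y)
      simpa [h] using IsUltrametricDist.norm_add_le_max (f.coeff y) (g.coeff y)
  neg_mem' {f} hf y := by
    have : (-f).coeff y = -f.coeff y := rfl
    simpa [this, termNorm] using hf y

/-- The series all of whose terms are smaller than a given nonzero term. -/
def belowSubgroup (hle : IsGMO le C) (P : RatPolytope n) {b : K} (hb : b ≠ 0) (w : Mon n) :
    AddSubgroup (PolytopalAlgebra K P) where
  carrier := {f | ∀ y, termKey hle P (f.coeff y) y < termKey hle P b w}
  zero_mem' y := termKey_lt_of_termNorm_lt (by simpa [termNorm] using termNorm_pos (P := P) hb w)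
  add_mem' {f g} hf hg y := (termKey_add_le _ _ _).trans_lt (max_lt (hf y) (hg y))
  neg_mem' {f} hf y := by
    have : (-f).coeff y = -f.coeff y := rfl
    simpa [this, termKey_neg] using hf y

theorem exists_sum_term_mul (g h : PolytopalAlgebra K P) {ε : ℝ} (hε : 0 < ε) :
    ∃ W : Finset (Mon n), g * h - ∑ w ∈ W, term (g.coeff w) w * h ∈ smallSubgroup K P hε := by
  classical
  obtain ⟨B, hB, hh⟩ := exists_termNorm_le h
  -- Truncating `g` at norm `ε / (2B)` leaves a tail whose product with `h` has terms of norm at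
  -- most `ε / 2`; the factor `2` makes the final bound strict.
  have hδ : 0 < ε / (2 * B) := by positivity
  refine ⟨(finite_le_termNorm g hδ).toFinset, fun y => ?_⟩
  rw [← Finset.sum_mul, ← sub_mul]
  set W := (finite_le_termNorm g hδ).toFinset with hW
  have hcoeff : ∀ w, (g - ∑ w ∈ W, term (g.coeff w) w).coeff w = if w ∈ W then 0 else g.coeff w := by
    intro w
    have : (∑ w ∈ W, (term (g.coeff w) w : PolytopalAlgebra K P)).coeff w =
        ∑ x ∈ W, if w = x then g.coeff x else 0 := by
      change coeffHom _ w = _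
      rw [map_sum, Finset.sum_apply]
      rfl
    rw [coeff_sub, this, Finset.sum_ite_eq]
    split_ifs <;> simp
  have hg : ∀ w, termNorm P ((g - ∑ w ∈ W, term (g.coeff w) w).coeff w) w ≤ ε / (2 * B) := by
    intro w
    rw [hcoeff]
    split_ifs with hw
    · simpa [termNorm] using hδ.le
    · rw [hW, Set.Finite.mem_toFinset] at hw
      exact (not_le.mp hw).le
  refine (termNorm_mul_le hδ.le hg hh y).trans_lt ?_
  have : ε / (2 * B) * B = ε / 2 := by field_simp
  linarith

omit [CompleteSpace K] in
theorem zero_term_mul (u : Mon n) (f : PolytopalAlgebra K P) : term 0 u * f = 0 :=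
  PolytopalAlgebra.ext (funext fun y => by rw [coeff_term_mul, zero_mul, coeff_zero])

omit [CompleteSpace K] in
theorem term_mul_term (a b : K) (u v : Mon n) :
    (term a u * term b v : PolytopalAlgebra K P) = term (a * b) (u + v) := by
  refine PolytopalAlgebra.ext (funext fun y => ?_)
  simp only [coeff_term_mul, coeff_term, sub_eq_iff_eq_add']
  split_ifs <;> simp

omit [IsUltrametricDist K] [CompleteSpace K] in
theorem term_add (a b : K) (u : Mon n) :
    (term (a + b) u : PolytopalAlgebra K P) = term a u + term b u := by
  refine PolytopalAlgebra.ext (funext fun y => ?_)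
  rw [coeff_add, coeff_term, coeff_term, coeff_term]
  split_ifs <;> simp

end Small

/-! ### Combinations of multiples of the divisors by terms -/

section Combination

variable [IsUltrametricDist K] [CompleteSpace K] {m : ℕ}

/-- The sum of the series encoded by the triples of `Q`. -/
noncomputable def sumEval (h : Fin m → PolytopalAlgebra K P) (Q : Multiset (K × Fin m × Mon n)) :
    PolytopalAlgebra K P :=
  (Q.map (termEval h)).sum

variable {h : Fin m → PolytopalAlgebra K P}

@[simp] theorem sumEval_zero : sumEval h 0 = 0 := rfl

@[simp] theorem sumEval_cons (q : K × Fin m × Mon n) (Q : Multiset (K × Fin m × Mon n)) :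
    sumEval h (q ::ₘ Q) = termEval h q + sumEval h Q := by
  simp [sumEval]

@[simp] theorem sumEval_add (Q R : Multiset (K × Fin m × Mon n)) :
    sumEval h (Q + R) = sumEval h Q + sumEval h R := by
  simp [sumEval]

/-- The triple encoding the product of `c X^t` with the series encoded by `e`. -/
def scaleTriple (c : K) (t : Mon n) (e : K × Fin m × Mon n) : K × Fin m × Mon n :=
  (c * e.1, e.2.1, t + e.2.2)

theorem termEval_scaleTriple (c : K) (t : Mon n) (e : K × Fin m × Mon n) :
    termEval h (scaleTriple c t e) = term c t * termEval h e := by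
  rw [termEval, termEval, scaleTriple, ← mul_assoc, term_mul_term]

theorem sumEval_map_scaleTriple (c : K) (t : Mon n) (Q : Multiset (K × Fin m × Mon n)) :
    sumEval h (Q.map (scaleTriple c t)) = term c t * sumEval h Q := by
  rw [sumEval, sumEval, Multiset.map_map, ← Multiset.sum_map_mul_left]
  exact congrArg _ (Multiset.map_congr rfl fun e _ => termEval_scaleTriple c t e)

/-- The triples encoding nonzero series whose leading term has norm at least `ε`. -/
noncomputable def largePart (le : Mon n → Mon n → Prop) (h : Fin m → PolytopalAlgebra K P) (ε : ℝ)
    (Q : Multiset (K × Fin m × Mon n)) : Multiset (K × Fin m × Mon n) :=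
  open Classical in Q.filter fun q => termEval h q ≠ 0 ∧ ε ≤ leadNorm le (termEval h q)

variable {le : Mon n → Mon n → Prop} {ι : Type*} {C : ι → AddSubmonoid (Mon n)}

omit [CompleteSpace K] in
theorem mem_largePart {ε : ℝ} {Q : Multiset (K × Fin m × Mon n)} {q : K × Fin m × Mon n} :
    q ∈ largePart le h ε Q ↔ q ∈ Q ∧ termEval h q ≠ 0 ∧ ε ≤ leadNorm le (termEval h q) := by
  classical
  exact Multiset.mem_filter

theorem sumEval_sub_largePart_mem (hle : IsGMO le C) {ε : ℝ} (hε : 0 < ε)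
    (Q : Multiset (K × Fin m × Mon n)) :
    sumEval h Q - sumEval h (largePart le h ε Q) ∈ smallSubgroup K P hε := by
  classical
  have hsplit := Multiset.filter_add_not
    (fun q => termEval h q ≠ 0 ∧ ε ≤ leadNorm le (termEval h q)) Q
  have : sumEval h Q - sumEval h (largePart le h ε Q) = sumEval h
      (Q.filter fun q => ¬(termEval h q ≠ 0 ∧ ε ≤ leadNorm le (termEval h q))) := by
    nth_rewrite 1 [← hsplit]
    rw [sumEval_add, sub_eq_iff_eq_add']
    congr!
  rw [this]
  refine AddSubgroup.multiset_sum_mem _ _ fun g hg => ?_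
  obtain ⟨q, hq, rfl⟩ := Multiset.mem_map.mp hg
  have hq' := (Multiset.mem_filter.mp hq).2
  by_cases h0 : termEval h q = 0
  · rw [h0]
    exact zero_mem _
  · refine fun y => (termNorm_le_leadNorm hle h0 y).trans_lt ?_
    by_contra! hc
    exact hq' ⟨h0, hc⟩

theorem exists_sub_sumEval_mem {f : PolytopalAlgebra K P} (hf : f ∈ Ideal.span (Set.range h))
    {ε : ℝ} (hε : 0 < ε) : ∃ Q, f - sumEval h Q ∈ smallSubgroup K P hε := by
  obtain ⟨g, rfl⟩ := Ideal.mem_span_range_iff_exists_fun.mp hf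
  refine Finset.sum_induction (fun k => g k * h k)
    (fun f => ∃ Q, f - sumEval h Q ∈ smallSubgroup K P hε) ?_ ⟨0, by simp [zero_mem]⟩ ?_
  · rintro a b ⟨Q, hQ⟩ ⟨R, hR⟩
    refine ⟨Q + R, ?_⟩
    rw [sumEval_add, add_sub_add_comm]
    exact add_mem hQ hR
  · intro k _
    obtain ⟨W, hW⟩ := exists_sum_term_mul (g k) (h k) hε
    refine ⟨W.val.map fun w => ((g k).coeff w, k, w), ?_⟩
    rw [sumEval, Multiset.map_map]
    exact hW

omit [CompleteSpace K] in
theorem exists_leadNorm_le (le : Mon n → Mon n → Prop) (h : Fin m → PolytopalAlgebra K P)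
    (Q : Multiset (K × Fin m × Mon n)) :
    ∃ B, 0 < B ∧ ∀ q ∈ Q, leadNorm le (termEval h q) ≤ B := by
  induction Q using Multiset.induction_on with
  | empty => exact ⟨1, one_pos, by simp⟩
  | cons q Q ih =>
    obtain ⟨B, hB, hQ⟩ := ih
    refine ⟨max B (leadNorm le (termEval h q)), lt_max_of_lt_left hB, fun r hr => ?_⟩
    rcases Multiset.mem_cons.mp hr with rfl | hr
    · exact le_max_right _ _
    · exact (hQ r hr).trans (le_max_left _ _)

end Combination

end PolytopalAlgebra

end Polytopal

namespace Polytopal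

namespace PolytopalAlgebra

variable {K : Type*} [NormedField K] [IsUltrametricDist K] [CompleteSpace K] {n : ℕ}
  {P : RatPolytope n} {D : Fin P.numVert → Type*} {T : ∀ i, D i → AddSubmonoid (Mon n)}
  {le : Mon n → Mon n → Prop} {m : ℕ} {h : Fin m → PolytopalAlgebra K P}

/-! ### Elimination of coincident leading terms -/

section Elimination

section Rank

variable {ι : Type*} {C : ι → AddSubmonoid (Mon n)} (hle : IsGMO le C)

/-- The rank of a series, by which the elimination of coincident leading terms terminates: first
the number of gaps `ρ` between `ε` and the norm of the leading term, then the leading monomial. -/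
noncomputable def leadRank (ρ ε : ℝ) (f : PolytopalAlgebra K P) :
    ℕ ×ₗ ((Fin P.numVert)ᵒᵈ ×ₗ OrdMon hle) :=
  toLex (gapCount ρ ε (leadNorm le f), monKey hle P (lm le f))

variable {hle}

omit [IsUltrametricDist K] [CompleteSpace K] in
-- A drop in the norm costs a whole factor `ρ`, hence lowers the gap count; with equal norms the
-- monomial key decreases.
theorem leadRank_lt {ρ ε : ℝ} (hρ0 : 0 < ρ) (hρ1 : ρ < 1) (hε : 0 < ε)
    {f g : PolytopalAlgebra K P} (hf : ε ≤ leadNorm le f) (hfg : leadKey hle f < leadKey hle g)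
    (hgap : leadNorm le f < leadNorm le g → leadNorm le f ≤ ρ * leadNorm le g) :
    leadRank hle ρ ε f < leadRank hle ρ ε g := by
  rw [leadRank, leadRank, Prod.Lex.toLex_lt_toLex]
  rcases termKey_lt_iff.mp hfg with h | ⟨h, hk⟩
  · exact .inl (gapCount_lt hρ0 hρ1 hε hf (hgap h))
  · exact .inr ⟨congrArg (gapCount ρ ε) h, hk⟩

omit [IsUltrametricDist K] [CompleteSpace K] in
theorem leadRank_eq_of_leadKey_eq {ρ ε : ℝ} {f g : PolytopalAlgebra K P}
    (hfg : leadKey hle f = leadKey hle g) : leadRank hle ρ ε f = leadRank hle ρ ε g := by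
  simp only [leadKey, termKey, EmbeddingLike.apply_eq_iff_eq, Prod.mk.injEq] at hfg
  rw [leadRank, leadRank, hfg.2]
  exact congrArg (fun x => toLex (gapCount ρ ε x, _)) hfg.1

end Rank

variable (hT : ∀ i, IsConicDecomposition (V K P i) (T i))
  (hle : IsGMO le fun x : (Σ i, D i) => T x.1 x.2)

include hT in
/-- If two multiples of `h_k` and `h_l` by terms have the same leading term up to a unit, then the
first is a multiple of the second, up to smaller multiples of the divisors and a small error. -/
theorem exists_elimination (h0 : ∀ k, h k ≠ 0)
    (U : ∀ i, D i → Fin m → Fin m → Finset (Mon n))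
    (hU : ∀ i (j : D i) (s k : Fin m), h s ≠ h k → GeneratesModule (T i j) (U i j s k)
      (lmConeSet le i (T i j) (h s) ∩ lmConeSet le i (T i j) (h k)))
    {ε B ρ : ℝ} (hε : 0 < ε) (hB : 0 < B)
    (E : ∀ i, D i → Fin m → Fin m → Mon n → Multiset (K × Fin m × Mon n))
    (hE : ∀ i (j : D i) (s k : Fin m), h s ≠ h k → ∀ v ∈ U i j s k,
      (∀ y, termNorm P ((sPair le i (T i j) (h s) (h k) v - sumEval h (E i j s k v)).coeff y) y <
        ε / B * termNorm P (lcCone le i (T i j) (h k) * lcCone le i (T i j) (h s)) v) ∧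
      ∀ e ∈ E i j s k v,
        (∃ x, IsLead hle (termEval h e) x ∧ termKey hle P ((termEval h e).coeff x) x <
          termKey hle P (lcCone le i (T i j) (h k) * lcCone le i (T i j) (h s)) v) ∧
        ∀ t ∈ T i j, ∀ y,
          termNorm P ((termEval h e).coeff y) (y + t) <
            termNorm P (lcCone le i (T i j) (h k) * lcCone le i (T i j) (h s)) v *
              Real.exp (gauge P t) →
          termNorm P ((termEval h e).coeff y) (y + t) ≤
            ρ * (termNorm P (lcCone le i (T i j) (h k) * lcCone le i (T i j) (h s)) v *
              Real.exp (gauge P t)))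
    {q r : K × Fin m × Mon n} (hq : termEval h q ≠ 0) (hr : termEval h r ≠ 0)
    (hqr : leadKey hle (termEval h q) = leadKey hle (termEval h r))
    (hqB : leadNorm le (termEval h q) ≤ B) :
    ∃ (γ : K) (F : Multiset (K × Fin m × Mon n)), ‖γ‖ = ‖r.1‖ ∧
      termEval h q - termEval h (γ, r.2) - sumEval h F ∈ smallSubgroup K P hε ∧
      ∀ e ∈ F, termEval h e ≠ 0 ∧ ε ≤ leadNorm le (termEval h e) ∧
        leadKey hle (termEval h e) < leadKey hle (termEval h q) ∧
        (leadNorm le (termEval h e) < leadNorm le (termEval h q) →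
          leadNorm le (termEval h e) ≤ ρ * leadNorm le (termEval h q)) := by
  obtain ⟨c, s, u⟩ := q
  obtain ⟨d, k, u'⟩ := r
  have hlq := isLead_lm hle hq
  have hlr := isLead_lm hle hr
  obtain ⟨hw, hnorm⟩ := eq_of_termKey_eq hqr
  rw [lc, lc, ← hw] at hnorm
  rw [← hw] at hlr
  rw [hlq.leadKey_eq, hlq.leadNorm_eq]
  rw [hlq.leadNorm_eq] at hqB
  set w := lm le (termEval h (c, s, u))
  clear hqr
  obtain ⟨i, hi⟩ : ∃ i, vertexIndex P w = i := ⟨_, rfl⟩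
  obtain ⟨j, hj⟩ : ∃ j : D i, w ∈ T i j := hi ▸ exists_mem_cone hT w
  have hwq : w = lmCone le i (T i j) (h s) + u := eq_of_isLead hT hle hlq hj hi
  have hwr : w = lmCone le i (T i j) (h k) + u' := eq_of_isLead hT hle hlr hj hi
  have htq : u ∈ coneSet le i (T i j) (h s) := mem_coneSet_of_isLead hlq hj hi
  have htr : u' ∈ coneSet le i (T i j) (h k) := mem_coneSet_of_isLead hlr hj hi
  obtain ⟨hls, hls0⟩ := lcCone_eq_coeff hT hle (h0 s) i j
  obtain ⟨hlk, hlk0⟩ := lcCone_eq_coeff hT hle (h0 k) i j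
  have hcq : (termEval h (c, s, u)).coeff w = c * lcCone le i (T i j) (h s) := by
    rw [termEval, coeff_term_mul, hls]
    simp only
    rw [sub_eq_of_eq_add hwq]
  have hcr : (termEval h (d, k, u')).coeff w = d * lcCone le i (T i j) (h k) := by
    rw [termEval, coeff_term_mul, hlk]
    simp only
    rw [sub_eq_of_eq_add hwr]
  -- Equal divisors, possibly with different indices, have no S-pair; but then the two multipliers
  -- coincide, and the first series is already a multiple of `X^u'` times the second divisor.
  by_cases hsk : h s = h k
  · refine ⟨c, 0, ?_, ?_, by simp⟩
    · rw [hcq, hcr, hsk, norm_mul, norm_mul] at hnorm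
      exact mul_right_cancel₀ (norm_ne_zero_iff.mpr hlk0) hnorm
    · have : u = u' := by
        simp only [hsk] at hwq
        exact add_left_cancel (hwq.symm.trans hwr)
      rw [termEval, termEval, sumEval_zero, sub_zero]
      simp only [this, hsk, sub_self]
      exact zero_mem _
  have hmem : w ∈ lmConeSet le i (T i j) (h s) ∩ lmConeSet le i (T i j) (h k) :=
    ⟨⟨u, htq, hwq⟩, ⟨u', htr, hwr⟩⟩
  have hgen := hU i j s k hsk
  rw [GeneratesModule] at hgen
  rw [hgen] at hmem
  -- The common leading monomial is a translate, by an element of the cone, of a generator `v` at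
  -- which an expansion is available.
  obtain ⟨t, ht, v, hv, hwt⟩ := hmem
  have hvmem : v ∈ lmConeSet le i (T i j) (h s) ∩ lmConeSet le i (T i j) (h k) := by
    rw [hgen]
    exact ⟨0, zero_mem _, v, hv, (zero_add v).symm⟩
  obtain ⟨tv, htv, hvt⟩ := hvmem.1
  -- The generator lies in the same cone as `t` and has index `i`, which is what compatibility of
  -- the term order with translation by `t` requires.
  have hvcone : v ∈ T i j ∧ vertexIndex P v = i := by
    have := mem_coneSet_iff.mp htv
    rwa [lm_mono_mul_eq hT hle (h0 s) htv, ← hvt] at this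
  obtain ⟨hE1, hE2⟩ := hE i j s k hsk v hv
  set b := lcCone le i (T i j) (h k) * lcCone le i (T i j) (h s) with hb
  have hb0 : b ≠ 0 := mul_ne_zero hlk0 hls0
  have hc0 : c ≠ 0 := fun hc => hlq.1 (by rw [hcq, hc, zero_mul])
  -- With this choice `γ X^t` carries the cancelled term `b X^v` of the S-pair to the leading term
  -- of the first series.
  set γ := c / lcCone le i (T i j) (h k) with hγ
  have hγ0 : γ ≠ 0 := div_ne_zero hc0 hlk0
  have hγb : γ * b = (termEval h (c, s, u)).coeff w := by
    rw [hcq, hγ, hb, ← mul_assoc, div_mul_cancel₀ _ hlk0]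
  have htdot : dot (P.vert i) t = gauge P t := dot_eq_gauge_of_mem hT ht
  have htdot' : dot (P.vert (vertexIndex P v)) t = gauge P t := by rw [hvcone.2, htdot]
  have hbw : termNorm P ((termEval h (c, s, u)).coeff w) w =
      ‖γ‖ * (termNorm P b v * Real.exp (gauge P t)) := by
    rw [← hγb, termNorm_mul, hwt, add_comm t v,
      termNorm_add_eq b (gauge_add_eq (dot_vertexIndex P v) htdot')]
  have hsmall : term γ t * (sPair le i (T i j) (h s) (h k) v - sumEval h (E i j s k v)) ∈
      smallSubgroup K P hε := by
    intro y
    have h1 := hE1 (y - t)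
    have h2 := termNorm_add_le (P := P) ((sPair le i (T i j) (h s) (h k) v -
      sumEval h (E i j s k v)).coeff (y - t)) (y - t) t
    rw [sub_add_cancel] at h2
    rw [coeff_term_mul, termNorm_mul]
    -- The relative error `ε / B` becomes at most `ε`, since the leading term of the first series
    -- has norm at most `B`.
    calc _ ≤ ‖γ‖ * (_ * Real.exp (gauge P t)) := mul_le_mul_of_nonneg_left h2 (norm_nonneg γ)
      _ < ‖γ‖ * (ε / B * termNorm P b v * Real.exp (gauge P t)) :=
        mul_lt_mul_of_pos_left (mul_lt_mul_of_pos_right h1 (Real.exp_pos _))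
          (norm_pos_iff.mpr hγ0)
      _ = ε / B * termNorm P ((termEval h (c, s, u)).coeff w) w := by rw [hbw]; ring
      _ ≤ ε / B * B := by gcongr
      _ = ε := div_mul_cancel₀ _ hB.ne'
  have hmain : termEval h (c, s, u) - termEval h (γ * lcCone le i (T i j) (h s), k, u') =
      term γ t * sPair le i (T i j) (h s) (h k) v := by
    rw [sPair, mul_sub, ← mul_assoc, ← mul_assoc, term_mul_term, term_mul_term, termEval, termEval]
    simp only
    congr 3
    · rw [hγ, div_mul_cancel₀ _ hlk0]
    · rw [← add_sub_assoc, ← hwt, hwq, add_sub_cancel_left]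
    · rw [← add_sub_assoc, ← hwt, hwr, add_sub_cancel_left]
  refine ⟨γ * lcCone le i (T i j) (h s),
    largePart le h ε ((E i j s k v).map (scaleTriple γ t)), ?_, ?_, ?_⟩
  · rw [hcq, hcr, norm_mul, norm_mul] at hnorm
    rw [hγ, norm_mul, norm_div, div_mul_eq_mul_div, hnorm,
      mul_div_cancel_right₀ _ (norm_ne_zero_iff.mpr hlk0)]
  · have h1 := sumEval_sub_largePart_mem hle hε ((E i j s k v).map (scaleTriple γ t)) (h := h)
    have h2 := add_mem hsmall h1
    rw [sumEval_map_scaleTriple, mul_sub, sub_add_sub_cancel] at h2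
    rwa [hmain]
  · intro e he
    obtain ⟨he1, he0, heε⟩ := mem_largePart.mp he
    obtain ⟨e', he', rfl⟩ := Multiset.mem_map.mp he1
    refine ⟨he0, heε, ?_⟩
    obtain ⟨⟨x, hx, hxv⟩, hgap⟩ := hE2 e' he'
    have hl := isLead_lm hle he0
    set y := lm le (termEval h (scaleTriple γ t e'))
    rw [hl.leadKey_eq, hl.leadNorm_eq, termEval_scaleTriple, coeff_term_mul]
    constructor
    · rw [← hγb, hwt, add_comm t v]
      refine termKey_mul_lt_mul hγ0 ?_
      have := termKey_add_lt_add (x := (⟨i, j⟩ : Σ i, D i)) hb0 hvcone.1 ht htdot'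
        ((hx.2 (y - t)).trans_lt hxv)
      rwa [sub_add_cancel] at this
    · rw [hbw, termNorm_mul]
      intro hlt
      have := hgap t ht (y - t)
      rw [sub_add_cancel] at this
      rw [mul_left_comm]
      exact mul_le_mul_of_nonneg_left (this (lt_of_mul_lt_mul_left hlt (norm_nonneg γ)))
        (norm_nonneg γ)

end Elimination

end PolytopalAlgebra

end Polytopal

/-! ### Descent on combinations of multiples of the divisors -/

namespace Polytopal

namespace PolytopalAlgebra

variable {K : Type*} [NormedField K] [IsUltrametricDist K] [CompleteSpace K] {n : ℕ}
  {P : RatPolytope n} {D : Fin P.numVert → Type*} {T : ∀ i, D i → AddSubmonoid (Mon n)}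
  {le : Mon n → Mon n → Prop} {m : ℕ} {h : Fin m → PolytopalAlgebra K P}

/-- The summand with the largest leading key is strictly above every other summand and above the
error, so its leading term survives in `f`. -/
theorem lm_eq_of_nodup {ι : Type*} {C : ι → AddSubmonoid (Mon n)} (hle : IsGMO le C)
    {f : PolytopalAlgebra K P} {Q : Multiset (K × Fin m × Mon n)} (hQ0 : Q ≠ 0)
    (hQ : ∀ q ∈ Q, termEval h q ≠ 0)
    (hf : ∀ q ∈ Q, ∀ y, termNorm P ((f - sumEval h Q).coeff y) y < leadNorm le (termEval h q))
    (hnodup : (Q.map fun q => leadKey hle (termEval h q)).Nodup) :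
    ∃ q ∈ Q, lm le f = lm le (termEval h q) := by
  classical
  obtain ⟨q, hq, hmax⟩ := Finset.exists_max_image Q.toFinset
    (fun q => leadKey hle (termEval h q)) (by
      obtain ⟨q, hq⟩ := Multiset.exists_mem_of_ne_zero hQ0
      exact ⟨q, Multiset.mem_toFinset.mpr hq⟩)
  rw [Multiset.mem_toFinset] at hq
  refine ⟨q, hq, ?_⟩
  obtain ⟨R, rfl⟩ := Multiset.exists_cons_of_mem hq
  have hl := isLead_lm hle (hQ q hq)
  rw [Multiset.map_cons, Multiset.nodup_cons] at hnodup
  have hR : sumEval h R ∈ belowSubgroup hle P hl.1 (lm le (termEval h q)) := by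
    refine AddSubgroup.multiset_sum_mem _ _ fun g hg => ?_
    obtain ⟨r, hr, rfl⟩ := Multiset.mem_map.mp hg
    have hr' := Multiset.mem_cons_of_mem hr (b := q)
    intro y
    refine ((isLead_lm hle (hQ r hr')).2 y).trans_lt ?_
    refine (hmax r (Multiset.mem_toFinset.mpr hr')).lt_of_ne fun he => hnodup.1 ?_
    exact Multiset.mem_map.mpr ⟨r, hr, he⟩
  have herr : f - sumEval h (q ::ₘ R) ∈ belowSubgroup hle P hl.1 (lm le (termEval h q)) :=
    fun y => termKey_lt_of_termNorm_lt (hf q hq y)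
  have := hl.add (add_mem hR herr)
  rw [sumEval_cons, ← add_assoc, add_sub_cancel] at this
  exact this.lm_eq

/-- If coincident leading terms can be eliminated, then the leading monomial of a combination of
multiples of the divisors by terms is the leading monomial of one such multiple. -/
theorem exists_lm_eq_of_elimination {ι : Type*} {C : ι → AddSubmonoid (Mon n)} (hle : IsGMO le C)
    [WellFoundedLT (OrdMon hle)] {f : PolytopalAlgebra K P} {ε B ρ : ℝ} (hε : 0 < ε)
    (hfε : ∃ y, ε ≤ termNorm P (f.coeff y) y) (hρ0 : 0 < ρ) (hρ1 : ρ < 1)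
    (hρ : ∀ a b : K, ‖a‖ < ‖b‖ → ‖a‖ ≤ ρ * ‖b‖)
    (helim : ∀ q r : K × Fin m × Mon n, termEval h q ≠ 0 → termEval h r ≠ 0 →
      leadKey hle (termEval h q) = leadKey hle (termEval h r) → leadNorm le (termEval h q) ≤ B →
      ∃ (γ : K) (F : Multiset (K × Fin m × Mon n)), ‖γ‖ = ‖r.1‖ ∧
        termEval h q - termEval h (γ, r.2) - sumEval h F ∈ smallSubgroup K P hε ∧
        ∀ e ∈ F, termEval h e ≠ 0 ∧ ε ≤ leadNorm le (termEval h e) ∧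
          leadKey hle (termEval h e) < leadKey hle (termEval h q) ∧
          (leadNorm le (termEval h e) < leadNorm le (termEval h q) →
            leadNorm le (termEval h e) ≤ ρ * leadNorm le (termEval h q)))
    (Q : Multiset (K × Fin m × Mon n)) (hQf : f - sumEval h Q ∈ smallSubgroup K P hε)
    (hQ : ∀ q ∈ Q, termEval h q ≠ 0 ∧ ε ≤ leadNorm le (termEval h q) ∧
      leadNorm le (termEval h q) ≤ B) :
    ∃ q, termEval h q ≠ 0 ∧ lm le f = lm le (termEval h q) := by
  classical
  let rank : K × Fin m × Mon n → ℕ ×ₗ ((Fin P.numVert)ᵒᵈ ×ₗ OrdMon hle) := fun q =>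
    leadRank hle ρ ε (termEval h q)
  -- The induction is on the multiset of ranks, for the order in which an element may be replaced by
  -- finitely many smaller ones.
  have wf : WellFounded (InvImage (Relation.TransGen (Relation.CutExpand (· < ·)))
      fun Q : Multiset (K × Fin m × Mon n) => Q.map rank) :=
    InvImage.wf _ wellFounded_lt.cutExpand.transGen
  induction Q using wf.induction with
  | _ Q ih =>
  by_cases hnodup : (Q.map fun q => leadKey hle (termEval h q)).Nodup
  -- An empty combination would make all terms of `f` smaller than `ε`.
  · have hQ0 : Q ≠ 0 := by
      rintro rfl
      rw [sumEval_zero, sub_zero] at hQf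
      obtain ⟨y, hy⟩ := hfε
      exact hy.not_gt (hQf y)
    obtain ⟨q, hq, hlm⟩ := lm_eq_of_nodup hle hQ0 (fun q hq => (hQ q hq).1)
      (fun q hq y => (hQf y).trans_le (hQ q hq).2.1) hnodup
    exact ⟨q, (hQ q hq).1, hlm⟩
  obtain ⟨q, r, R, rfl, hqr⟩ : ∃ q r R, Q = q ::ₘ r ::ₘ R ∧
      leadKey hle (termEval h q) = leadKey hle (termEval h r) := by
    rw [Multiset.nodup_iff_ne_cons_cons] at hnodup
    push Not at hnodup
    obtain ⟨a, t, hat⟩ := hnodup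
    obtain ⟨q, hq, hqa, hqt⟩ := (Multiset.map_eq_cons _ _ _ _).mpr hat
    obtain ⟨r, hr, hra, -⟩ := (Multiset.map_eq_cons _ _ _ _).mpr hqt
    refine ⟨q, r, (Q.erase q).erase r, ?_, hqa.trans hra.symm⟩
    rw [Multiset.cons_erase hr, Multiset.cons_erase hq]
  have hq := hQ q (Multiset.mem_cons_self _ _)
  have hr := hQ r (Multiset.mem_cons_of_mem (Multiset.mem_cons_self _ _))
  obtain ⟨γ, F, hγ, hF, hF'⟩ := helim q r hq.1 hr.1 hqr hq.2.2
  -- The multiple produced by the elimination uses the same monomial and divisor as `r`, so the two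
  -- merge into one triple. It may be zero or too small, in which case it is discarded.
  set r' : K × Fin m × Mon n := (r.1 + γ, r.2) with hr'
  set S := largePart le h ε {r'} with hS
  have hnorm : ‖r.1 + γ‖ ≤ ‖r.1‖ := by
    have := IsUltrametricDist.norm_add_le_max r.1 γ
    rwa [hγ, max_self] at this
  have hr1 : r.1 ≠ 0 := fun h0 => hr.1 (by rw [termEval, h0, zero_term_mul])
  have hhr : h r.2.1 ≠ 0 := fun h0 => hr.1 (by rw [termEval, h0, mul_zero])
  have hSr : ∀ e ∈ S, termEval h e ≠ 0 ∧ ε ≤ leadNorm le (termEval h e) ∧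
      leadNorm le (termEval h e) ≤ leadNorm le (termEval h r) ∧
      rank e ≤ rank r := by
    intro e he
    obtain ⟨he1, he2, he3⟩ := mem_largePart.mp he
    rw [Multiset.mem_singleton] at he1
    subst he1
    have hc : r.1 + γ ≠ 0 := fun h0 => he2 (by
      rw [termEval, show r'.1 = 0 from h0, zero_term_mul])
    have hlm : lm le (termEval h r') = lm le (termEval h r) := by
      rw [termEval, termEval, lm_term_mul hle hhr hc, lm_term_mul hle hhr hr1]
    have hcoef : lc le (termEval h r') * r.1 = lc le (termEval h r) * (r.1 + γ) := by
      rw [lc, lc, hlm, termEval, termEval, coeff_term_mul, coeff_term_mul]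
      ring
    have hN : leadNorm le (termEval h r') * ‖r.1‖ = leadNorm le (termEval h r) * ‖r.1 + γ‖ := by
      rw [leadNorm, leadNorm, mul_comm, ← termNorm_mul, mul_comm _ ‖_‖, ← termNorm_mul, hlm,
        mul_comm r.1, hcoef, mul_comm]
    have hr1' : 0 < ‖r.1‖ := norm_pos_iff.mpr hr1
    have hpos := leadNorm_pos hle hr.1
    have hleN : leadNorm le (termEval h r') ≤ leadNorm le (termEval h r) := by
      refine le_of_mul_le_mul_right ?_ hr1'
      rw [hN]
      gcongr
    refine ⟨he2, he3, hleN, ?_⟩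
    -- The merged coefficient is no larger than that of `r`. If it is strictly smaller, discreteness
    -- of `K` provides the factor `ρ`; otherwise the leading key, and so the rank, is unchanged.
    rcases hleN.lt_or_eq with hlt | heq
    · refine (leadRank_lt hρ0 hρ1 hε he3 (termKey_lt_of_termNorm_lt hlt) fun _ => ?_).le
      have hlt' : ‖r.1 + γ‖ < ‖r.1‖ := by
        refine lt_of_mul_lt_mul_left ?_ hpos.le
        rw [← hN]
        gcongr
      refine le_of_mul_le_mul_right ?_ hr1'
      rw [hN, mul_comm ρ, mul_assoc]
      exact mul_le_mul_of_nonneg_left (hρ _ _ hlt') hpos.le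
    · refine (leadRank_eq_of_leadKey_eq ?_).le
      exact congrArg₂ (fun x y => toLex (x, y)) heq (congrArg _ hlm)
  have hFrank : ∀ e ∈ F, rank e < rank q := fun e he =>
    leadRank_lt hρ0 hρ1 hε (hF' e he).2.1 (hF' e he).2.2.1 (hF' e he).2.2.2
  refine ih (S + F + R) ?_ ?_ ?_
  · change Relation.TransGen _ (Multiset.map rank _) (Multiset.map rank _)
    -- The rank of `q` is replaced by the smaller ranks of `F`. This is the strict decrease; the
    -- passage from `r` to the merged triple may leave the multiset as it is.
    have h1 : Relation.CutExpand (· < ·) (rank r ::ₘ (F.map rank + R.map rank))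
        (Multiset.map rank (q ::ₘ r ::ₘ R)) := by
      refine ⟨F.map rank, rank q, ?_, ?_⟩
      · intro a ha
        obtain ⟨e, he, rfl⟩ := Multiset.mem_map.mp ha
        exact hFrank e he
      · simp only [← Multiset.singleton_add, Multiset.map_add, Multiset.map_singleton]
        abel
    have h2 : Multiset.map rank (S + F + R) = rank r ::ₘ (F.map rank + R.map rank) ∨
        Relation.CutExpand (· < ·) (Multiset.map rank (S + F + R))
          (rank r ::ₘ (F.map rank + R.map rank)) := by
      -- Either the rank of `r` is replaced by at most one smaller rank, the case of a discarded
      -- triple included, or `S` is a single triple of the same rank.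
      by_cases hSlt : ∀ e ∈ S, rank e < rank r
      · right
        refine ⟨S.map rank, rank r, ?_, ?_⟩
        · intro a ha
          obtain ⟨e, he, rfl⟩ := Multiset.mem_map.mp ha
          exact hSlt e he
        · simp only [Multiset.map_add, ← Multiset.singleton_add]
          abel
      · left
        push Not at hSlt
        obtain ⟨e, he, hre⟩ := hSlt
        have hS1 : S = {e} := by
          have hle1 : S ≤ {r'} := Multiset.filter_le _ _
          have h3 := Multiset.card_le_card hle1
          rw [Multiset.card_singleton] at h3
          refine (Multiset.eq_of_le_of_card_le (Multiset.singleton_le.mpr he) ?_).symm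
          simpa using h3
        rw [hS1, Multiset.map_add, Multiset.map_add, Multiset.map_singleton,
          le_antisymm (hSr e he).2.2.2 hre, ← Multiset.singleton_add, add_assoc]
    rcases h2 with h2 | h2
    · rw [h2]
      exact .single h1
    · exact .tail (.single h2) h1
  · have h1 := sumEval_sub_largePart_mem hle hε {r'} (h := h)
    rw [← hS] at h1
    have h2 := add_mem (add_mem hQf hF) h1
    have h3 : sumEval h {r'} = termEval h r + termEval h (γ, r.2) := by
      rw [sumEval, Multiset.map_singleton, Multiset.sum_singleton, termEval, termEval, termEval,
        ← add_mul, ← term_add]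
    rw [h3, sumEval_cons, sumEval_cons] at h2
    rw [sumEval_add, sumEval_add]
    convert h2 using 1
    abel
  · intro e he
    rcases Multiset.mem_add.mp he with he | he
    · rcases Multiset.mem_add.mp he with he | he
      · exact ⟨(hSr e he).1, (hSr e he).2.1, (hSr e he).2.2.1.trans hr.2.2⟩
      · exact ⟨(hF' e he).1, (hF' e he).2.1,
          (termNorm_le_of_termKey_le (hF' e he).2.2.1.le).trans hq.2.2⟩
    · exact hQ e (Multiset.mem_cons_of_mem (Multiset.mem_cons_of_mem he))

/-! ### The Buchberger criterion -/

section Buchberger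

variable (hT : ∀ i, IsConicDecomposition (V K P i) (T i))
  (hle : IsGMO le fun x : (Σ i, D i) => T x.1 x.2)

include hT hle

omit [CompleteSpace K] in
/-- The leading monomial of a multiple of a divisor by a term lies in the set which a Gröbner basis
has to exhaust. -/
theorem lm_termEval_mem {q : K × Fin m × Mon n} (hq : termEval h q ≠ 0) :
    lm le (termEval h q) ∈ ⋃ g ∈ Set.range h, ⋃ i, ⋃ j, lmConeSet le i (T i j) g := by
  have hl := isLead_lm hle hq
  obtain ⟨j, hj⟩ := exists_mem_cone hT (lm le (termEval h q))
  simp only [Set.mem_iUnion]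
  exact ⟨h q.2.1, ⟨_, rfl⟩, _, j, q.2.2, mem_coneSet_of_isLead hl hj rfl,
    eq_of_isLead hT hle hl hj rfl⟩

omit [CompleteSpace K] in
theorem exists_lm_eq_of_mem_lmConeSet {g : PolytopalAlgebra K P} (hg : g ≠ 0) {i : Fin P.numVert}
    {j : D i} {w : Mon n} (hw : w ∈ lmConeSet le i (T i j) g) :
    ∃ t, mono t * g ≠ 0 ∧ lm le (mono t * g) = w ∧ w = lmCone le i (T i j) g + t := by
  obtain ⟨t, ht, rfl⟩ := hw
  exact ⟨t, term_mul_ne_zero one_ne_zero t hg, lm_mono_mul_eq hT hle hg ht, rfl⟩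

/-- The division algorithm succeeds with zero remainder on the ideal of a Gröbner basis. -/
theorem IsGroebnerBasis.hasRemainder_zero (h0 : ∀ k, h k ≠ 0)
    (hG : IsGroebnerBasis le T (Ideal.span (Set.range h)) (Set.range h))
    {f : PolytopalAlgebra K P} (hf : f ∈ Ideal.span (Set.range h)) {run : ℕ → DivState K P m}
    (hrun : IsDivRun le T h f run) : HasRemainder run 0 := by
  refine hasRemainder_zero_of_rem_eq_zero fun N => (hrun.rem_eq_zero
    (fun k => Ideal.subset_span (Set.mem_range_self k)) (fun f hf hf0 => ?_) hf N).2
  have hmem : lm le f ∈ {u | ∃ f ∈ Ideal.span (Set.range h), f ≠ 0 ∧ lm le f = u} :=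
    ⟨f, hf, hf0, rfl⟩
  rw [hG.lm_eq] at hmem
  simp only [Set.mem_iUnion] at hmem
  obtain ⟨g, ⟨k, rfl⟩, i, j, hw⟩ := hmem
  obtain ⟨t, -, h1, h2⟩ := exists_lm_eq_of_mem_lmConeSet hT hle (h0 k) hw
  exact ⟨i, j, k, by rw [factor, sub_eq_of_eq_add' h2, h1]⟩

omit hT hle in
theorem sPair_mem {J : Ideal (PolytopalAlgebra K P)} {f g : PolytopalAlgebra K P} (hf : f ∈ J)
    (hg : g ∈ J) (i : Fin P.numVert) (C : AddSubmonoid (Mon n)) (v : Mon n) :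
    sPair le i C f g v ∈ J :=
  J.sub_mem (J.mul_mem_left _ hf) (J.mul_mem_left _ hg)

/-- The constants depend on each other in order: `ε` on `f`, then an approximating combination and
its bound `B`, then expansions of the finitely many S-pairs to relative precision `ε / B`, and only
at the end the gap `ρ`, which is a property of these expansions. -/
theorem isGroebnerBasis_of_exists_hasRemainder_zero (hK : IsDiscretelyValued K)
    (h0 : ∀ k, h k ≠ 0) (U : ∀ i, D i → Fin m → Fin m → Finset (Mon n))
    (hU : ∀ i (j : D i) (s k : Fin m), h s ≠ h k → GeneratesModule (T i j) (U i j s k)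
      (lmConeSet le i (T i j) (h s) ∩ lmConeSet le i (T i j) (h k)))
    (hS : ∀ i (j : D i) (s k : Fin m), h s ≠ h k → ∀ v ∈ U i j s k,
      ∃ run, IsDivRun le T h (sPair le i (T i j) (h s) (h k) v) run ∧ HasRemainder run 0) :
    IsGroebnerBasis le T (Ideal.span (Set.range h)) (Set.range h) := by
  have : WellFoundedLT (OrdMon hle) := wellFoundedLT_ordMon_of_isConicDecomposition hT hle
  have : ∀ i, Finite (D i) := fun i => (hT i).finite
  refine ⟨Set.finite_range h, ?_, Set.Subset.antisymm ?_ ?_⟩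
  · rintro _ ⟨k, rfl⟩
    exact ⟨Ideal.subset_span (Set.mem_range_self k), h0 k⟩
  · rintro _ ⟨f, hf, hf0, rfl⟩
    set ε := leadNorm le f with hε_def
    have hε : 0 < ε := leadNorm_pos hle hf0
    obtain ⟨Q₀, hQ₀⟩ := exists_sub_sumEval_mem hf hε
    obtain ⟨B, hB, hQB⟩ := exists_leadNorm_le le h Q₀
    have hexp : ∀ i (j : D i) (s k : Fin m) v, ∃ E : Multiset (K × Fin m × Mon n),
        h s ≠ h k → v ∈ U i j s k →
        (∀ y, termNorm P ((sPair le i (T i j) (h s) (h k) v - sumEval h E).coeff y) y <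
          ε / B * termNorm P (lcCone le i (T i j) (h k) * lcCone le i (T i j) (h s)) v) ∧
        ∀ e ∈ E, ∃ x, IsLead hle (termEval h e) x ∧ termKey hle P ((termEval h e).coeff x) x <
          termKey hle P (lcCone le i (T i j) (h k) * lcCone le i (T i j) (h s)) v := by
      intro i j s k v
      by_cases hsk : h s = h k
      · exact ⟨0, fun hne => absurd hsk hne⟩
      by_cases hv : v ∈ U i j s k
      · obtain ⟨run, hrun, hrem⟩ := hS i j s k hsk v hv
        have hvmem : v ∈ lmConeSet le i (T i j) (h s) ∩ lmConeSet le i (T i j) (h k) := by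
          rw [hU i j s k hsk]
          exact ⟨0, zero_mem _, v, hv, (zero_add v).symm⟩
        have hpos : 0 < termNorm P (lcCone le i (T i j) (h k) * lcCone le i (T i j) (h s)) v :=
          termNorm_pos (mul_ne_zero (lcCone_eq_coeff hT hle (h0 k) i j).2
            (lcCone_eq_coeff hT hle (h0 s) i j).2) v
        obtain ⟨E, hE⟩ := hrun.exists_expansion hT hle hK h0 hrem
          (termKey_sPair_lt hT hle (h0 s) (h0 k) hvmem.1 hvmem.2)
          (mul_pos (div_pos hε hB) hpos)
        exact ⟨E, fun _ _ => hE⟩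
      · exact ⟨0, fun _ h => absurd h hv⟩
    choose E hE using hexp
    -- Only finitely many series occur in the expansions, but their translates by a cone are
    -- infinitely many; the uniform gap for vertex cones handles all translations at once.
    have hgap : ∀ᶠ ρ in 𝓝[<] (1 : ℝ), ∀ i, ∀ (j : D i) (s k : Fin m), ∀ v ∈ U i j s k,
        ∀ e ∈ E i j s k v, ∀ t ∈ T i j, ∀ y,
          termNorm P ((termEval h e).coeff y) (y + t) <
            termNorm P (lcCone le i (T i j) (h k) * lcCone le i (T i j) (h s)) v *
              Real.exp (gauge P t) →
          termNorm P ((termEval h e).coeff y) (y + t) ≤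
            ρ * (termNorm P (lcCone le i (T i j) (h k) * lcCone le i (T i j) (h s)) v *
              Real.exp (gauge P t)) := by
      classical
      refine Filter.eventually_all.mpr fun i => Filter.eventually_all.mpr fun j =>
        Filter.eventually_all.mpr fun s => Filter.eventually_all.mpr fun k =>
        (Filter.eventually_all_finite (U i j s k).finite_toSet).mpr fun v _ =>
        (Filter.eventually_all_finite (I := {e | e ∈ E i j s k v}) ?_).mpr fun e _ => ?_
      · exact (E i j s k v).toFinset.finite_toSet.subset fun e he => Multiset.mem_toFinset.mpr he
      · have hpos : 0 < termNorm P (lcCone le i (T i j) (h k) * lcCone le i (T i j) (h s)) v :=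
          termNorm_pos (mul_ne_zero (lcCone_eq_coeff hT hle (h0 k) i j).2
            (lcCone_eq_coeff hT hle (h0 s) i j).2) v
        filter_upwards [eventually_gap (termEval h e) i hpos] with ρ hρ t ht
        exact hρ t (dot_eq_gauge_of_mem hT ht)
    obtain ⟨ρ, ⟨hρ0, hρ1⟩, hρ, hρE⟩ :=
      ((eventually_mem_set.mpr (Ioo_mem_nhdsLT (zero_lt_one (α := ℝ)))).and
        ((eventually_gap_norm hK).and hgap)).exists
    obtain ⟨q, hq, hlm⟩ := exists_lm_eq_of_elimination hle hε (f := f) (B := B)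
      ⟨lm le f, le_rfl⟩ hρ0 hρ1 hρ
      (fun q r hq hr hqr hqB => exists_elimination hT hle h0 U hU hε hB E
        (fun i j s k hsk v hv => ⟨(hE i j s k v hsk hv).1, fun e he =>
          ⟨(hE i j s k v hsk hv).2 e he, hρE i j s k v hv e he⟩⟩) hq hr hqr hqB)
      (largePart le h ε Q₀)
      (by simpa using add_mem hQ₀ (sumEval_sub_largePart_mem (h := h) hle hε Q₀))
      (fun q hq => by
        obtain ⟨h1, h2, h3⟩ := mem_largePart.mp hq
        exact ⟨h2, h3, hQB q h1⟩)
    rw [hlm]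
    exact lm_termEval_mem hT hle hq
  -- Conversely, each monomial of the union is the leading monomial of a monomial multiple of a
  -- divisor, which lies in the ideal.
  · intro w hw
    simp only [Set.mem_iUnion] at hw
    obtain ⟨g, ⟨k, rfl⟩, i, j, hw⟩ := hw
    obtain ⟨t, h1, h2, -⟩ := exists_lm_eq_of_mem_lmConeSet hT hle (h0 k) hw
    exact ⟨mono t * h k, Ideal.mul_mem_left _ _ (Ideal.subset_span (Set.mem_range_self k)), h1, h2⟩

end Buchberger

end PolytopalAlgebra

end Polytopal

open Polytopal PolytopalAlgebra in
theorem mainTheorem1 {K : Type*} [NormedField K] [IsUltrametricDist K] [CompleteSpace K]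
    (hK : IsDiscretelyValued K) {n : ℕ} (P : RatPolytope n)
    {D : Fin P.numVert → Type*} (T : ∀ i, D i → AddSubmonoid (Mon n))
    (hT : ∀ i, IsConicDecomposition (V K P i) (T i))
    (le : Mon n → Mon n → Prop) (hle : IsGMO le fun x : (Σ i, D i) => T x.1 x.2)
    {m : ℕ} (h : Fin m → PolytopalAlgebra K P) (h_ne : ∀ k, h k ≠ 0)
    (U : ∀ i, D i → Fin m → Fin m → Finset (Mon n))
    (hU : ∀ i (j : D i) (s k : Fin m), h s ≠ h k → GeneratesModule (T i j) (U i j s k)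
      (lmConeSet le i (T i j) (h s) ∩ lmConeSet le i (T i j) (h k))) :
    List.TFAE [
      IsGroebnerBasis le T (Ideal.span (Set.range h)) (Set.range h),
      ∀ i (j : D i) (s k : Fin m), h s ≠ h k → ∀ v ∈ U i j s k,
        ∀ run, IsDivRun le T h (sPair le i (T i j) (h s) (h k) v) run → HasRemainder run 0,
      ∀ i (j : D i) (s k : Fin m), h s ≠ h k → ∀ v ∈ U i j s k,
        ∃ run, IsDivRun le T h (sPair le i (T i j) (h s) (h k) v) run ∧ HasRemainder run 0] := by
  tfae_have 1 → 2 := fun hG i j s k _ v _ run hrun =>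
    hG.hasRemainder_zero hT hle h_ne
      (sPair_mem (Ideal.subset_span (Set.mem_range_self s))
        (Ideal.subset_span (Set.mem_range_self k)) i _ v) hrun
  tfae_have 2 → 3 := fun h2 i j s k hsk v hv => by
    obtain ⟨run, hrun⟩ := exists_isDivRun le T h (sPair le i (T i j) (h s) (h k) v)
    exact ⟨run, hrun, h2 i j s k hsk v hv run hrun⟩
  tfae_have 3 → 1 := isGroebnerBasis_of_exists_hasRemainder_zero hT hle hK h_ne U hU
  tfae_finish
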